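/- **Theorem 7 (Inoue).** Let $X=(X_n)_{n\in\mathbb Z}$ be a zero-mean, wide-sense stationary, complex-valued stochastic process with finite variance. Let $\mu$ be its spectral measure, i.e. the finite measure on the unit circle (parametrised by $e^{i\theta}$) with $E[X_n\overline{X_0}]=\int e^{-in\theta}\,d\mu(\theta)$ for all $n\in\mathbb Z$, and let $w$ be its spectral density, i.e. the density of the absolutely continuous part of $\mu$ with respect to $d\theta/2\pi$. Call $X$ *minimal* if, for every $n$, $X_n$ does not lie in the closed linear span in $L_2$ of $\{X_m : m\neq n\}$. Call $X$ *non-deterministic* if $\sigma>0$, where $\sigma$ is the $L_2$-distance of $X_0$ from the closed linear span of $\{X_m : m\le -1\}$; in that case $\log w\in L_1$, and the Szegő (outer) function $h$ and the $AR(\infty)$ coefficients $r=(r_n)_{n\ge 0}$ are defined, for $|z|<1$, by $$h(z)=\exp\Bigl(\frac1{4\pi}\int_0^{2\pi}\frac{e^{i\theta}+z}{e^{i\theta}-z}\,\log w(\theta)\,d\theta\Bigr),\qquad -\frac1{h(z)}=\sum_{n=0}^\infty r_nz^n .$$ Then the following are equivalent: (i) $X$ is minimal; (i′) (Kolmogorov's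 criterion) $1/w\in L_1$, i.e. $\int_0^{2\pi} \frac{d\theta}{w(\theta)}<\infty$, where $1/0=\infty$; (ii) $X$ is non-deterministic and its $AR(\infty)$ coefficients satisfy $r\in\ell_2$; (iii) $X$ is non-deterministic and $1/h$ lies in the Hardy space $H_2$ of the unit disc, i.e. $1/h$ is analytic in the disc and $\sup_{0\le\rho<1}\frac1{2\pi}\int_0^{2\pi}|1/h(\rho e^{i\theta})|^2\,d\theta<\infty$. -/

import Mathlib

open MeasureTheory AddCircle
open scoped ENNReal ComplexConjugate

noncomputable section

namespace Prediction

instance factTwoPiPos : Fact (0 < 2 * Real.pi) := ⟨Real.two_pi_pos⟩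

/-- A zero-mean, wide-sense stationary, complex-valued process in discrete time. -/
structure IsStationary {Ω : Type*} [MeasurableSpace Ω] (X : ℤ → Ω → ℂ) (P : Measure Ω) :
    Prop where
  memLp : ∀ n, MemLp (X n) 2 P
  mean_zero : ∀ n, ∫ ω, X n ω ∂P = 0
  cov_shift : ∀ m n k, ∫ ω, X (m + k) ω * conj (X (n + k) ω) ∂P = ∫ ω, X m ω * conj (X n ω) ∂P

section TimeDomain

variable {Ω : Type*} [MeasurableSpace Ω] {X : ℤ → Ω → ℂ} {P : Measure Ω}

/-- `X n` as an element of the Hilbert space `L²(P)`. -/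
def toL2 (hX : IsStationary X P) (n : ℤ) : Lp ℂ 2 P := (hX.memLp n).toLp (X n)

/-- The closed linear span in `L²(P)` of the values `X n` at the times `n ∈ I`. -/
def cls (hX : IsStationary X P) (I : Set ℤ) : Submodule ℂ (Lp ℂ 2 P) :=
  (Submodule.span ℂ (toL2 hX '' I)).topologicalClosure

instance (hX : IsStationary X P) (I : Set ℤ) : (cls hX I).HasOrthogonalProjection := by
  unfold cls; infer_instance

/-- The one-step root-mean-square prediction error `σ = ‖X 0 - P_{(-∞,-1]} X 0‖`. -/
def sigma (hX : IsStationary X P) : ℝ :=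
  ‖toL2 hX 0 - (cls hX (Set.Iic (-1))).starProjection (toL2 hX 0)‖

/-- Non-determinism: the one-step prediction error is positive. -/
def IsNonDeterministic (hX : IsStationary X P) : Prop := 0 < sigma hX

/-- Minimality: no value of the process lies in the closed linear span of all the others. -/
def IsMinimal (hX : IsStationary X P) : Prop := ∀ n, toL2 hX n ∉ cls hX {m | m ≠ n}

/-- `μ` is the spectral measure of `X` if it is a finite measure on the circle `ℝ / 2πℤ` with
`E[X_n conj(X_0)] = ∫ e^{-inθ} dμ(θ)` for all `n`. -/
def IsSpectralMeasure (X : ℤ → Ω → ℂ) (P : Measure Ω) (μ : Measure (AddCircle (2 * Real.pi))) :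
    Prop :=
  IsFiniteMeasure μ ∧ ∀ n : ℤ, ∫ ω, X n ω * conj (X 0 ω) ∂P = ∫ θ, fourier (-n) θ ∂μ

open Classical in
/-- The spectral measure of `X`. For a stationary process it exists (Herglotz), and it is unique. -/
def spectralMeasure (X : ℤ → Ω → ℂ) (P : Measure Ω) : Measure (AddCircle (2 * Real.pi)) :=
  if h : ∃ μ, IsSpectralMeasure X P μ then h.choose else 0

end TimeDomain

section FrequencyDomain

/-- The spectral density: the density of the absolutely continuous part of `μ` with respect to
normalized Lebesgue measure `dθ / 2π`. -/
def density (μ : Measure (AddCircle (2 * Real.pi))) : AddCircle (2 * Real.pi) → ℝ≥0∞ :=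
  μ.rnDeriv haarAddCircle

/-- The Szegő function
`h(z) = exp ((1 / 4π) ∫ (e^{iθ} + z) / (e^{iθ} - z) log w(θ) dθ)`, for `|z| < 1`;
here `haarAddCircle` is `dθ / 2π`. It is meaningful when `log w` is integrable. -/
def szegoFunction (μ : Measure (AddCircle (2 * Real.pi))) (z : ℂ) : ℂ :=
  Complex.exp ((1 / 2) * ∫ θ, (fourier 1 θ + z) / (fourier 1 θ - z) *
    (Real.log (density μ θ).toReal : ℂ) ∂haarAddCircle)

/-- The autoregressive coefficients: the Maclaurin coefficients of `-1 / h`. -/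
def arCoeff (μ : Measure (AddCircle (2 * Real.pi))) (n : ℕ) : ℂ :=
  iteratedDeriv n (fun z => -1 / szegoFunction μ z) 0 / (n.factorial : ℂ)

/-- Membership in the Hardy space `H_p` of the unit disc. -/
def MemHardy (p : ℝ) (f : ℂ → ℂ) : Prop :=
  DifferentiableOn ℂ f (Metric.ball 0 1) ∧
    ∃ C : ℝ, ∀ r : ℝ, 0 ≤ r → r < 1 →
      (Real.circleAverage (fun z => ‖f z‖ ^ p) 0 r) ^ (1 / p) ≤ C

end FrequencyDomain

end Prediction

end

/-! Herglotz's theorem supplies the spectral measure `μ`, and `X_{-m} ↦ e^{imθ}` is then an isometry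
into `L²(μ)`. If `X_0` lies at positive distance from the span of the `X_n`, `n ∈ I`, then `δ |a_0|²
≤ ∫ |f|² dμ` for every trigonometric polynomial `f` with frequencies in `{0} ∪ -I` and constant
coefficient `a_0`.

Minimality. When `I` is all `n ≠ 0`, density extends the inequality to continuous `f` and then to
bounded measurable `f ≥ 0`. The test function `1/(w+ε)`, cut off on the null set carrying the
singular part, gives `∫ 1/(w+ε) ≤ 1/δ`, and Fatou gives `1/w ∈ L¹` (`lintegral_inv_density_lt_top`).
Conversely, `1/w ∈ L¹` and a Cauchy–Schwarz argument bound the distance from `X_n` to the other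
values below.

Non-determinism. When `I` is the past, only polynomials in `e^{iθ}` are available. Applied to `exp
g`, whose constant coefficient is `exp (g 0)`, the inequality becomes `δ exp (∫ v) ≤ ∫ e^v dμ` for
`v = 2 Re g`, hence for all real continuous `v`. Truncations of `v = -log w` then show that `w > 0`
a.e. and `log w ∈ L¹` (`integrable_log_density_of_notMem`). Only this half of Szegő's theorem is
needed.

Hardy space. `|1/h(re^{it})|²` is the exponential of the Poisson integral of `-log w`. Jensen bounds
its means by `∫ 1/w`; conversely, a.e. boundary convergence along a sequence of radii and Fatou
bound `∫ 1/w` by the `H₂` norm. Parseval on circles identifies `1/h ∈ H₂` with `r ∈ ℓ₂`. -/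

namespace Prediction

open Filter Topology

/-! ### Existence of the spectral measure, by Fejér means. -/

section Herglotz

variable {Ω : Type*} [MeasurableSpace Ω] {X : ℤ → Ω → ℂ} {P : Measure Ω}

/-- The autocovariance function of a process. -/
noncomputable def autocov (X : ℤ → Ω → ℂ) (P : Measure Ω) (n : ℤ) : ℂ :=
  ∫ ω, X n ω * conj (X 0 ω) ∂P

/-- The inner product is conjugate-linear in its first argument, hence `n - m` and not `m - n`. -/
lemma inner_toL2 (hX : IsStationary X P) (m n : ℤ) :
    inner ℂ (toL2 hX m) (toL2 hX n) = autocov X P (n - m) := by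
  have h := hX.cov_shift (n - m) 0 m
  simp only [sub_add_cancel, zero_add] at h
  rw [autocov, ← h, L2.inner_def]
  refine integral_congr_ae ?_
  filter_upwards [(hX.memLp m).coeFn_toLp, (hX.memLp n).coeFn_toLp] with ω hm hn
  simp only [toL2, hm, hn, RCLike.inner_apply]

/-- The Fejér means of the spectral measure, as functions on the circle. -/
noncomputable def fejerDensity (hX : IsStationary X P) (N : ℕ) (θ : AddCircle (2 * Real.pi)) : ℝ :=
  ((N : ℝ) + 1)⁻¹ * ‖∑ k ∈ Finset.range (N + 1), fourier (k : ℤ) θ • toL2 hX k‖ ^ 2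

lemma continuous_fejerDensity (hX : IsStationary X P) (N : ℕ) : Continuous (fejerDensity hX N) := by
  unfold fejerDensity
  fun_prop

lemma fejerDensity_nonneg (hX : IsStationary X P) (N : ℕ) (θ : AddCircle (2 * Real.pi)) :
    0 ≤ fejerDensity hX N θ := by
  unfold fejerDensity
  positivity

/-- Expanding the squared norm shows that a Fejér sum of autocovariances is nonnegative: this is
where positive-definiteness enters. -/
lemma ofReal_fejerDensity (hX : IsStationary X P) (N : ℕ) (θ : AddCircle (2 * Real.pi)) :
    (fejerDensity hX N θ : ℂ) = ((N : ℂ) + 1)⁻¹ * ∑ k ∈ Finset.range (N + 1),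
      ∑ j ∈ Finset.range (N + 1), autocov X P ((j : ℤ) - k) * fourier ((j : ℤ) - k) θ := by
  rw [fejerDensity]
  push_cast
  congr 1
  refine (inner_self_eq_norm_sq_to_K (𝕜 := ℂ)
    (∑ k ∈ Finset.range (N + 1), fourier (k : ℤ) θ • toL2 hX k)).symm.trans ?_
  rw [sum_inner]
  refine Finset.sum_congr rfl fun k _ => ?_
  rw [inner_sum]
  refine Finset.sum_congr rfl fun j _ => ?_
  rw [inner_smul_left, inner_smul_right, inner_toL2, sub_eq_add_neg (j : ℤ), fourier_add,
    fourier_neg]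
  ring

lemma integral_fourier (n : ℤ) :
    ∫ θ : AddCircle (2 * Real.pi), fourier n θ ∂haarAddCircle = if n = 0 then 1 else 0 := by
  have h := congrFun (fourierCoeff_fourier (T := 2 * Real.pi) n) 0
  simp only [fourierCoeff, neg_zero, fourier_zero, one_smul, Pi.single_apply] at h
  rw [h]
  simp [eq_comm]

lemma integrable_of_continuous {E : Type*} [NormedAddCommGroup E]
    {μ : Measure (AddCircle (2 * Real.pi))} [IsFiniteMeasure μ] {f : AddCircle (2 * Real.pi) → E}
    (hf : Continuous f) : Integrable f μ := by
  simpa using hf.continuousOn.integrableOn_compact (μ := μ) isCompact_univ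

/-- Only the pairs with `j - k = n` survive integration. Their number is kept as a cardinality,
which avoids splitting on the sign of `n`. -/
lemma integral_fourier_mul_fejerDensity (hX : IsStationary X P) (N : ℕ) (n : ℤ) :
    ∫ θ, fourier (-n) θ * (fejerDensity hX N θ : ℂ) ∂haarAddCircle =
      autocov X P n * ((((Finset.range (N + 1)).filter
        fun k : ℕ => 0 ≤ k + n ∧ k + n < N + 1).card / ((N : ℝ) + 1) : ℝ) : ℂ) := by
  have h1 : ∀ θ : AddCircle (2 * Real.pi), fourier (-n) θ * (fejerDensity hX N θ : ℂ) =
      ∑ k ∈ Finset.range (N + 1), ∑ j ∈ Finset.range (N + 1),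
        (((N : ℂ) + 1)⁻¹ * autocov X P ((j : ℤ) - k)) * fourier ((j : ℤ) - k - n) θ := by
    intro θ
    rw [ofReal_fejerDensity, Finset.mul_sum, Finset.mul_sum]
    refine Finset.sum_congr rfl fun k _ => ?_
    rw [Finset.mul_sum, Finset.mul_sum]
    refine Finset.sum_congr rfl fun j _ => ?_
    rw [sub_eq_add_neg _ n, fourier_add]
    ring
  simp_rw [h1]
  rw [integral_finsetSum _ fun k _ => integrable_of_continuous (by fun_prop)]
  have h2 : ∀ k ∈ Finset.range (N + 1), ∫ θ : AddCircle (2 * Real.pi),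
      ∑ j ∈ Finset.range (N + 1), (((N : ℂ) + 1)⁻¹ * autocov X P ((j : ℤ) - k)) *
        fourier ((j : ℤ) - k - n) θ ∂haarAddCircle =
      if 0 ≤ (k : ℤ) + n ∧ (k : ℤ) + n < N + 1 then ((N : ℂ) + 1)⁻¹ * autocov X P n else 0 := by
    intro k _
    rw [integral_finsetSum _ fun k _ => integrable_of_continuous (by fun_prop)]
    simp_rw [integral_const_mul, integral_fourier]
    split_ifs with h
    · obtain ⟨j, hj⟩ := Int.eq_ofNat_of_zero_le h.1
      rw [Finset.sum_eq_single j]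
      · have : (j : ℤ) - k = n := by omega
        simp [this]
      · intro i _ hij
        rw [if_neg (by omega), mul_zero]
      · intro hj'
        exact absurd (Finset.mem_range.2 (by omega)) hj'
    · refine Finset.sum_eq_zero fun j hj => ?_
      rw [if_neg, mul_zero]
      have := Finset.mem_range.1 hj
      omega
  rw [Finset.sum_congr rfl h2, ← Finset.sum_filter, Finset.sum_const, nsmul_eq_mul]
  push_cast
  ring

lemma tendsto_fejer_weight (n : ℤ) :
    Tendsto (fun N : ℕ => (((Finset.range (N + 1)).filter
        fun k : ℕ => 0 ≤ k + n ∧ k + n < N + 1).card / ((N : ℝ) + 1) : ℝ)) atTop (𝓝 1) := by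
  have hlow : Tendsto (fun N : ℕ => 1 - (2 * n.natAbs : ℝ) * (1 / ((N : ℝ) + 1))) atTop (𝓝 1) := by
    simpa using (tendsto_one_div_add_atTop_nhds_zero_nat (𝕜 := ℝ)).const_mul (2 * n.natAbs : ℝ)
      |>.const_sub 1
  refine tendsto_of_tendsto_of_tendsto_of_le_of_le hlow tendsto_const_nhds (fun N => ?_)
    (fun N => ?_)
  · have hpos : (0 : ℝ) < (N : ℝ) + 1 := by positivity
    -- A crude interval that works for both signs of `n`; it loses `2|n|` terms instead of `|n|`,
    -- which is harmless in the limit.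
    have hsub : Finset.Ico n.natAbs (N + 1 - n.natAbs) ⊆ (Finset.range (N + 1)).filter
        fun k : ℕ => 0 ≤ k + n ∧ k + n < N + 1 := by
      intro k hk
      simp only [Finset.mem_Ico, Finset.mem_filter, Finset.mem_range] at hk ⊢
      omega
    have hcard := Finset.card_le_card hsub
    rw [Nat.card_Ico] at hcard
    have h3 : N + 1 ≤ ((Finset.range (N + 1)).filter
        fun k : ℕ => 0 ≤ k + n ∧ k + n < N + 1).card + 2 * n.natAbs := by omega
    have h4 : (N : ℝ) + 1 ≤ ((Finset.range (N + 1)).filter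
        fun k : ℕ => 0 ≤ k + n ∧ k + n < N + 1).card + 2 * (n.natAbs : ℝ) := by exact_mod_cast h3
    change 1 - (2 * n.natAbs : ℝ) * (1 / ((N : ℝ) + 1)) ≤ _
    rw [le_div_iff₀ hpos]
    field_simp
    linarith
  · have hpos : (0 : ℝ) < (N : ℝ) + 1 := by positivity
    refine (div_le_one hpos).2 ?_
    have := Finset.card_filter_le (Finset.range (N + 1))
      fun k : ℕ => 0 ≤ k + n ∧ k + n < N + 1
    rw [Finset.card_range] at this
    exact_mod_cast this

/-- The Fejér means of the spectral measure. -/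
noncomputable def fejerMeasure (hX : IsStationary X P) (N : ℕ) :
    FiniteMeasure (AddCircle (2 * Real.pi)) :=
  ⟨haarAddCircle.withDensity fun θ => ENNReal.ofReal (fejerDensity hX N θ),
    isFiniteMeasure_withDensity_ofReal
      (integrable_of_continuous (continuous_fejerDensity hX N)).2⟩

lemma integral_fourier_fejerMeasure (hX : IsStationary X P) (N : ℕ) (n : ℤ) :
    ∫ θ, fourier (-n) θ ∂(fejerMeasure hX N : Measure (AddCircle (2 * Real.pi))) =
      autocov X P n * ((((Finset.range (N + 1)).filter
        fun k : ℕ => 0 ≤ k + n ∧ k + n < N + 1).card / ((N : ℝ) + 1) : ℝ) : ℂ) := by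
  rw [← integral_fourier_mul_fejerDensity hX]
  change ∫ θ, fourier (-n) θ ∂(haarAddCircle.withDensity fun θ =>
    ENNReal.ofReal (fejerDensity hX N θ)) = _
  rw [integral_withDensity_eq_integral_toReal_smul
    (continuous_fejerDensity hX N).measurable.ennreal_ofReal (by simp)]
  refine integral_congr_ae (Eventually.of_forall fun θ => ?_)
  simp only [ENNReal.toReal_ofReal (fejerDensity_nonneg hX N θ), Complex.real_smul]
  ring

lemma mass_fejerMeasure (hX : IsStationary X P) (N : ℕ) :
    ((fejerMeasure hX N).mass : ℝ) = (autocov X P 0).re := by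
  have h := integral_fourier_fejerMeasure hX N 0
  simp only [neg_zero, fourier_zero, integral_const, Complex.real_smul, mul_one] at h
  have hf : ((Finset.range (N + 1)).filter
      fun k : ℕ => 0 ≤ (k : ℤ) + 0 ∧ (k : ℤ) + 0 < N + 1).card = N + 1 := by
    rw [Finset.filter_true_of_mem, Finset.card_range]
    intro k hk
    have := Finset.mem_range.1 hk
    omega
  have hN : (N : ℝ) + 1 ≠ 0 := by positivity
  rw [hf, Nat.cast_add_one, div_self hN, Complex.ofReal_one, mul_one] at h
  rw [← h, Complex.ofReal_re]
  rfl

/-- **Herglotz's theorem**: a stationary process has a spectral measure. -/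
theorem exists_isSpectralMeasure (hX : IsStationary X P) : ∃ μ, IsSpectralMeasure X P μ := by
  have hK := isCompact_setOfPred_finiteMeasure_le_of_compactSpace (AddCircle (2 * Real.pi))
    (autocov X P 0).re.toNNReal
  have hle : ((hyperfilter ℕ).map (fejerMeasure hX) : Filter _) ≤
      𝓟 {μ : FiniteMeasure (AddCircle (2 * Real.pi)) | μ.mass ≤ (autocov X P 0).re.toNNReal} := by
    refine le_principal_iff.2 (mem_map.2 (univ_mem' fun N => ?_))
    exact NNReal.coe_le_coe.1 ((mass_fejerMeasure hX N).le.trans (Real.le_coe_toNNReal _))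
  -- A limit along a nonprincipal ultrafilter takes the place of a weakly convergent subsequence.
  obtain ⟨μ, -, hμ⟩ := hK.ultrafilter_le_nhds ((hyperfilter ℕ).map (fejerMeasure hX)) hle
  refine ⟨μ, inferInstance, fun n => ?_⟩
  have hμ' : Tendsto (fejerMeasure hX) (hyperfilter ℕ) (𝓝 μ) := hμ
  have h1 := (FiniteMeasure.tendsto_iff_forall_integral_rclike_tendsto ℂ).1 hμ'
    (BoundedContinuousFunction.mkOfCompact (fourier (-n)))
  have h2 : Tendsto (fun N => autocov X P n * ((((Finset.range (N + 1)).filter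
        fun k : ℕ => 0 ≤ k + n ∧ k + n < N + 1).card / ((N : ℝ) + 1) : ℝ) : ℂ))
      (hyperfilter ℕ) (𝓝 (autocov X P n)) := by
    have := ((Complex.continuous_ofReal.tendsto 1).comp (tendsto_fejer_weight n)).const_mul
      (autocov X P n)
    simp only [Complex.ofReal_one, mul_one] at this
    exact this.mono_left Nat.hyperfilter_le_atTop
  refine tendsto_nhds_unique h2 (h1.congr fun N => ?_)
  exact integral_fourier_fejerMeasure hX N n

theorem isSpectralMeasure_spectralMeasure (hX : IsStationary X P) :
    IsSpectralMeasure X P (spectralMeasure X P) := by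
  rw [spectralMeasure, dif_pos (exists_isSpectralMeasure hX)]
  exact (exists_isSpectralMeasure hX).choose_spec

end Herglotz

/-! ### The isometry between the time domain and `L²(μ)`. -/

section Isometry

variable {Ω : Type*} [MeasurableSpace Ω] {X : ℤ → Ω → ℂ} {P : Measure Ω}

/-- The minus sign in `E[X_n conj X_0] = ∫ e^{-inθ} dμ` makes `e^{imθ}` correspond to `X_{-m}`; the
inner products then agree term by term. -/
lemma norm_sq_linearCombination_toL2 (hX : IsStationary X P)
    {μ : Measure (AddCircle (2 * Real.pi))} (hμ : IsSpectralMeasure X P μ) (l : ℤ →₀ ℂ) :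
    ‖Finsupp.linearCombination ℂ (fun m => toL2 hX (-m)) l‖ ^ 2 =
      ∫ θ, ‖Finsupp.linearCombination ℂ (fourier (T := 2 * Real.pi)) l θ‖ ^ 2 ∂μ := by
  have := hμ.1
  apply Complex.ofReal_injective
  have hint : ∀ θ : AddCircle (2 * Real.pi),
      ((‖Finsupp.linearCombination ℂ (fourier (T := 2 * Real.pi)) l θ‖ ^ 2 : ℝ) : ℂ) =
      ∑ m ∈ l.support, ∑ n ∈ l.support, conj (l m) * (l n * fourier (-(m - n)) θ) := by
    intro θ
    rw [Complex.ofReal_pow, ← Complex.conj_mul', Finsupp.linearCombination_apply, Finsupp.sum,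
      ContinuousMap.coe_sum, Finset.sum_apply, map_sum, Finset.sum_mul_sum]
    refine Finset.sum_congr rfl fun m _ => Finset.sum_congr rfl fun n _ => ?_
    rw [neg_sub, sub_eq_add_neg, fourier_add, fourier_neg]
    simp only [ContinuousMap.smul_apply, smul_eq_mul, map_mul]
    ring
  rw [← integral_complex_ofReal]
  simp_rw [hint]
  rw [integral_finsetSum _ fun k _ => integrable_of_continuous (by fun_prop)]
  rw [Complex.ofReal_pow]
  refine (inner_self_eq_norm_sq_to_K (𝕜 := ℂ)
    (Finsupp.linearCombination ℂ (fun m => toL2 hX (-m)) l)).symm.trans ?_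
  rw [Finsupp.linearCombination_apply, Finsupp.sum, sum_inner]
  refine Finset.sum_congr rfl fun m _ => ?_
  rw [inner_sum, integral_finsetSum _ fun k _ => integrable_of_continuous (by fun_prop)]
  refine Finset.sum_congr rfl fun n _ => ?_
  rw [inner_smul_left, inner_smul_right, inner_toL2, autocov, hμ.2, integral_const_mul,
    integral_const_mul]
  congr 5
  ring_nf

lemma exists_pos_mul_norm_le {E : Type*} [NormedAddCommGroup E] [NormedSpace ℂ E]
    {S : Submodule ℂ E} {x : E} (hx : x ∉ S.topologicalClosure) :
    ∃ δ > 0, ∀ (a : ℂ), ∀ s ∈ S, δ * ‖a‖ ≤ ‖a • x + s‖ := by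
  have hx' : x ∉ closure (S : Set E) := hx
  rw [Metric.mem_closure_iff] at hx'
  push Not at hx'
  obtain ⟨δ, hδ, h⟩ := hx'
  refine ⟨δ, hδ, fun a s hs => ?_⟩
  rcases eq_or_ne a 0 with rfl | ha
  · simp
  · have h1 := h (-(a⁻¹ • s)) (S.neg_mem (S.smul_mem _ hs))
    rw [dist_eq_norm, sub_neg_eq_add] at h1
    have h2 : a • x + s = a • (x + a⁻¹ • s) := by rw [smul_add, smul_inv_smul₀ ha]
    rw [h2, norm_smul, mul_comm]
    gcongr

lemma integral_fourier_neg_mul_linearCombination (l : ℤ →₀ ℂ) (n : ℤ) :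
    ∫ θ, fourier (-n) θ * Finsupp.linearCombination ℂ (fourier (T := 2 * Real.pi)) l θ
      ∂haarAddCircle = l n := by
  have h : ∀ θ, fourier (-n) θ * Finsupp.linearCombination ℂ (fourier (T := 2 * Real.pi)) l θ =
      ∑ m ∈ l.support, l m * fourier (m - n) θ := by
    intro θ
    simp only [Finsupp.linearCombination_apply, Finsupp.sum, ContinuousMap.coe_sum,
      Finset.sum_apply, ContinuousMap.smul_apply, smul_eq_mul, Finset.mul_sum]
    refine Finset.sum_congr rfl fun m _ => ?_
    rw [sub_eq_add_neg, fourier_add]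
    ring
  simp_rw [h]
  rw [integral_finsetSum _ fun k _ => integrable_of_continuous (by fun_prop)]
  simp_rw [integral_const_mul, integral_fourier, sub_eq_zero]
  simp [eq_comm]

/-- If `X 0` is not in the closed span of the `X n`, `n ∈ I`, then the constant coefficient of a
trigonometric polynomial with the corresponding frequencies is controlled by its norm in
`L²(μ)`. -/
lemma exists_pos_mul_sq_integral_le (hX : IsStationary X P)
    {μ : Measure (AddCircle (2 * Real.pi))} (hμ : IsSpectralMeasure X P μ) {I : Set ℤ}
    (h : toL2 hX 0 ∉ cls hX I) :
    ∃ δ > 0, ∀ f ∈ Submodule.span ℂ (fourier (T := 2 * Real.pi) '' {m | m = 0 ∨ -m ∈ I}),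
      δ * ‖∫ θ, f θ ∂haarAddCircle‖ ^ 2 ≤ ∫ θ, ‖f θ‖ ^ 2 ∂μ := by
  obtain ⟨δ, hδ, hle⟩ := exists_pos_mul_norm_le h
  refine ⟨δ ^ 2, by positivity, fun f hf => ?_⟩
  obtain ⟨l, hl, rfl⟩ := (Finsupp.mem_span_image_iff_linearCombination ℂ).1 hf
  rw [← norm_sq_linearCombination_toL2 hX hμ, ← mul_pow]
  have h0 : ∫ θ, Finsupp.linearCombination ℂ (fourier (T := 2 * Real.pi)) l θ ∂haarAddCircle =
      l 0 := by
    simpa using integral_fourier_neg_mul_linearCombination l 0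
  rw [h0]
  gcongr
  have hsplit : Finsupp.linearCombination ℂ (fun m => toL2 hX (-m)) l =
      l 0 • toL2 hX 0 + Finsupp.linearCombination ℂ (fun m => toL2 hX (-m)) (l.erase 0) := by
    conv_lhs => rw [← Finsupp.single_add_erase 0 l]
    rw [map_add, Finsupp.linearCombination_single, neg_zero]
  rw [hsplit]
  refine hle _ _ ?_
  rw [Finsupp.linearCombination_apply, Finsupp.sum]
  refine Submodule.sum_mem _ fun m hm => Submodule.smul_mem _ _ (Submodule.subset_span ?_)
  rw [Finsupp.support_erase, Finset.mem_erase] at hm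
  exact ⟨-m, (hl hm.2).resolve_left hm.1, rfl⟩

end Isometry

/-! ### From continuous to measurable test functions; removal of the singular part. -/

section Approximation

lemma continuous_integral_continuousMap {E : Type*} [NormedAddCommGroup E] [NormedSpace ℝ E]
    [CompleteSpace E]
    (μ : Measure (AddCircle (2 * Real.pi))) [IsFiniteMeasure μ] :
    Continuous fun g : C(AddCircle (2 * Real.pi), E) => ∫ θ, g θ ∂μ := by
  have h : (fun g : C(AddCircle (2 * Real.pi), E) => ∫ θ, g θ ∂μ) =
      fun g => ∫ θ, (ContinuousMap.toLp 1 μ ℝ g) θ ∂μ := by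
    funext g
    exact integral_congr_ae (ContinuousMap.coeFn_toLp μ g).symm
  rw [h]
  exact continuous_integral.comp (ContinuousMap.toLp 1 μ ℝ).continuous

lemma continuous_integral_comp_continuousMap {E : Type*} [NormedAddCommGroup E]
    {φ : E → ℝ} (hφ : Continuous φ)
    (μ : Measure (AddCircle (2 * Real.pi))) [IsFiniteMeasure μ] :
    Continuous fun g : C(AddCircle (2 * Real.pi), E) => ∫ θ, φ (g θ) ∂μ :=
  (continuous_integral_continuousMap μ).comp
    (ContinuousMap.continuous_postcomp (⟨φ, hφ⟩ : C(E, ℝ)))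

/-- `L¹` approximation, an a.e. convergent subsequence, and clamping to `[0, M]`, which keeps
dominated convergence available. -/
lemma exists_continuousMap_tendsto_ae (ν : Measure (AddCircle (2 * Real.pi))) [IsFiniteMeasure ν]
    {u : AddCircle (2 * Real.pi) → ℝ} (hu : Measurable u) {M : ℝ} (h0 : ∀ θ, 0 ≤ u θ)
    (hM : ∀ θ, u θ ≤ M) :
    ∃ v : ℕ → C(AddCircle (2 * Real.pi), ℝ), (∀ n θ, 0 ≤ v n θ ∧ v n θ ≤ M) ∧
      ∀ᵐ θ ∂ν, Tendsto (fun n => v n θ) atTop (𝓝 (u θ)) := by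
  have hM0 : 0 ≤ M := (h0 0).trans (hM 0)
  have hmem : MemLp u 1 ν := MemLp.of_bound hu.aestronglyMeasurable M
    (Eventually.of_forall fun θ => by rw [Real.norm_of_nonneg (h0 θ)]; exact hM θ)
  have hex : ∀ n : ℕ, ∃ g : BoundedContinuousFunction (AddCircle (2 * Real.pi)) ℝ,
      eLpNorm (u - ⇑g) 1 ν ≤ ((n : ℝ≥0∞) + 1)⁻¹ ∧ MemLp g 1 ν := fun n =>
    hmem.exists_boundedContinuous_eLpNorm_sub_le ENNReal.one_ne_top
      (ENNReal.inv_ne_zero.2 (by finiteness))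
  choose g hg hg' using hex
  have hlim : Tendsto (fun n => eLpNorm (⇑(g n) - u) 1 ν) atTop (𝓝 0) := by
    have h1 : Tendsto (fun n : ℕ => ((n : ℝ≥0∞) + 1)⁻¹) atTop (𝓝 0) := by
      have := (ENNReal.tendsto_inv_nat_nhds_zero).comp (tendsto_add_atTop_nat 1)
      simpa [Function.comp_def] using this
    refine tendsto_of_tendsto_of_tendsto_of_le_of_le tendsto_const_nhds h1 (fun _ => zero_le)
      fun n => ?_
    simp only [eLpNorm_sub_comm]
    exact hg n
  obtain ⟨ns, -, hns⟩ := (tendstoInMeasure_of_tendsto_eLpNorm one_ne_zero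
    (fun n => (hg' n).1) hu.aestronglyMeasurable hlim).exists_seq_tendsto_ae
  refine ⟨fun n => ⟨fun θ => max 0 (min M (g (ns n) θ)), by fun_prop⟩, fun n θ =>
    ⟨le_max_left _ _, max_le hM0 (min_le_left _ _)⟩, ?_⟩
  filter_upwards [hns] with θ hθ
  have hc : Continuous fun x : ℝ => max 0 (min M x) := by fun_prop
  have := (hc.tendsto (u θ)).comp hθ
  rwa [min_eq_right (hM θ), max_eq_right (h0 θ)] at this

/-- An inequality between integrals that holds for continuous functions with values in `[0, M]`
holds for measurable ones. -/
lemma integral_comp_le_of_continuousMap (μ : Measure (AddCircle (2 * Real.pi))) [IsFiniteMeasure μ]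
    {φ Φ : ℝ → ℝ} (hφ : Continuous φ) (hΦ : Continuous Φ)
    (h : ∀ v : C(AddCircle (2 * Real.pi), ℝ), Φ (∫ θ, v θ ∂haarAddCircle) ≤ ∫ θ, φ (v θ) ∂μ)
    {u : AddCircle (2 * Real.pi) → ℝ} (hu : Measurable u) {M : ℝ} (h0 : ∀ θ, 0 ≤ u θ)
    (hM : ∀ θ, u θ ≤ M) :
    Φ (∫ θ, u θ ∂haarAddCircle) ≤ ∫ θ, φ (u θ) ∂μ := by
  -- Approximating for the sum of the two measures gives one sequence that converges a.e. for both.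
  obtain ⟨v, hv, hlim⟩ := exists_continuousMap_tendsto_ae (μ + haarAddCircle) hu h0 hM
  rw [ae_add_measure_iff] at hlim
  obtain ⟨C, hC⟩ := isCompact_Icc.exists_bound_of_continuousOn (s := Set.Icc 0 M) hφ.continuousOn
  have h1 : Tendsto (fun n => ∫ θ, v n θ ∂haarAddCircle) atTop
      (𝓝 (∫ θ, u θ ∂haarAddCircle)) := by
    refine tendsto_integral_of_dominated_convergence (fun _ => M)
      (fun n => (v n).continuous.aestronglyMeasurable) (integrable_const M)
      (fun n => Eventually.of_forall fun θ => ?_) hlim.2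
    rw [Real.norm_of_nonneg (hv n θ).1]
    exact (hv n θ).2
  have h2 : Tendsto (fun n => ∫ θ, φ (v n θ) ∂μ) atTop (𝓝 (∫ θ, φ (u θ) ∂μ)) := by
    refine tendsto_integral_of_dominated_convergence (fun _ => C)
      (fun n => (hφ.comp (v n).continuous).aestronglyMeasurable) (integrable_const C)
      (fun n => Eventually.of_forall fun θ => hC _ (hv n θ)) ?_
    filter_upwards [hlim.1] with θ hθ using (hφ.tendsto _).comp hθ
  exact le_of_tendsto_of_tendsto' ((hΦ.tendsto _).comp h1) h2 fun n => h (v n)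

/-- `S` carries the singular part, so a test function cut off on `S` sees only the density, while
its Haar integral is unchanged. -/
lemma exists_restrict_compl_eq_withDensity_density (μ : Measure (AddCircle (2 * Real.pi)))
    [IsFiniteMeasure μ] :
    ∃ S, MeasurableSet S ∧ haarAddCircle S = 0 ∧
      μ.restrict Sᶜ = haarAddCircle.withDensity (density μ) := by
  obtain ⟨S, hS, h1, h2⟩ := Measure.mutuallySingular_singularPart μ haarAddCircle
  refine ⟨Sᶜ, hS.compl, h2, ?_⟩
  rw [compl_compl]
  conv_lhs => rw [← Measure.singularPart_add_rnDeriv μ haarAddCircle]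
  rw [Measure.restrict_add, Measure.restrict_eq_zero.2 h1, zero_add, restrict_withDensity hS,
    Measure.restrict_eq_self_of_ae_mem (by rwa [ae_iff])]
  rfl

lemma measurable_density (μ : Measure (AddCircle (2 * Real.pi))) : Measurable (density μ) :=
  Measure.measurable_rnDeriv _ _

lemma density_lt_top (μ : Measure (AddCircle (2 * Real.pi))) [IsFiniteMeasure μ] :
    ∀ᵐ θ ∂haarAddCircle, density μ θ < ∞ :=
  Measure.rnDeriv_lt_top _ _

lemma integrable_toReal_density (μ : Measure (AddCircle (2 * Real.pi))) [IsFiniteMeasure μ] :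
    Integrable (fun θ => (density μ θ).toReal) haarAddCircle :=
  Measure.integrable_toReal_rnDeriv

end Approximation

/-! ### Kolmogorov's criterion for minimality. -/

section Kolmogorov

variable {Ω : Type*} [MeasurableSpace Ω] {X : ℤ → Ω → ℂ} {P : Measure Ω}
  {μ : Measure (AddCircle (2 * Real.pi))}

/-- All frequencies are allowed here, and trigonometric polynomials are uniformly dense while both
sides are continuous in the sup norm. -/
lemma exists_pos_mul_sq_integral_le_of_notMem (hX : IsStationary X P)
    (hμ : IsSpectralMeasure X P μ) (h : toL2 hX 0 ∉ cls hX {m | m ≠ 0}) :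
    ∃ δ > 0, ∀ v : C(AddCircle (2 * Real.pi), ℝ),
      δ * (∫ θ, v θ ∂haarAddCircle) ^ 2 ≤ ∫ θ, v θ ^ 2 ∂μ := by
  have := hμ.1
  obtain ⟨δ, hδ, hle⟩ := exists_pos_mul_sq_integral_le hX hμ h
  have hI : {m : ℤ | m = 0 ∨ -m ∈ {m : ℤ | m ≠ 0}} = Set.univ := by
    ext m
    simp [em]
  rw [hI, Set.image_univ] at hle
  have hclosed : IsClosed {f : C(AddCircle (2 * Real.pi), ℂ) |
      δ * ‖∫ θ, f θ ∂haarAddCircle‖ ^ 2 ≤ ∫ θ, ‖f θ‖ ^ 2 ∂μ} :=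
    isClosed_le (((continuous_integral_continuousMap haarAddCircle).norm.pow 2).const_mul δ)
      (continuous_integral_comp_continuousMap (φ := fun z : ℂ => ‖z‖ ^ 2) (by fun_prop) μ)
  have hall : ∀ f : C(AddCircle (2 * Real.pi), ℂ),
      δ * ‖∫ θ, f θ ∂haarAddCircle‖ ^ 2 ≤ ∫ θ, ‖f θ‖ ^ 2 ∂μ := by
    intro f
    have hf : f ∈ (Submodule.span ℂ (Set.range (fourier (T := 2 * Real.pi)))).topologicalClosure := by
      rw [span_fourier_closure_eq_top]
      trivial
    exact closure_minimal hle hclosed hf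
  refine ⟨δ, hδ, fun v => ?_⟩
  have h1 := hall ⟨fun θ => (v θ : ℂ), by fun_prop⟩
  simpa [integral_complex_ofReal] using h1

/-- Kolmogorov's criterion, necessity. -/
theorem lintegral_inv_density_lt_top (hX : IsStationary X P)
    (hμ : IsSpectralMeasure X P μ) (h : toL2 hX 0 ∉ cls hX {m | m ≠ 0}) :
    ∫⁻ θ, (density μ θ)⁻¹ ∂haarAddCircle < ∞ := by
  have := hμ.1
  obtain ⟨δ, hδ, hle⟩ := exists_pos_mul_sq_integral_le_of_notMem hX hμ h
  obtain ⟨S, hS, hS0, hrestr⟩ := exists_restrict_compl_eq_withDensity_density μ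
  have hSae : ∀ᵐ θ ∂haarAddCircle, θ ∈ Sᶜ := by
    rw [ae_iff]
    simpa using hS0
  have hmeas := (measurable_density μ).ennreal_toReal
  -- With `g = 1/(w+ε)` off `S` and `I = ∫ g`, the inequality reads `δ I² ≤ ∫ w/(w+ε)² ≤ I`, so `I ≤
  -- 1/δ` uniformly in `ε`.
  have hbound : ∀ ε : ℝ, 0 < ε →
      ∫⁻ θ, ENNReal.ofReal ((density μ θ).toReal + ε)⁻¹ ∂haarAddCircle ≤ ENNReal.ofReal δ⁻¹ := by
    intro ε hε
    set g : AddCircle (2 * Real.pi) → ℝ := fun θ => ((density μ θ).toReal + ε)⁻¹ with hg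
    have hgm : Measurable g := (hmeas.add_const ε).inv
    have hg0 : ∀ θ, 0 ≤ g θ := fun θ => by positivity
    have hgε : ∀ θ, g θ ≤ ε⁻¹ := fun θ => by
      refine inv_anti₀ hε ?_
      linarith [ENNReal.toReal_nonneg (a := density μ θ)]
    have hgi : Integrable g haarAddCircle := Integrable.of_bound hgm.aestronglyMeasurable ε⁻¹
      (Eventually.of_forall fun θ => by rw [Real.norm_of_nonneg (hg0 θ)]; exact hgε θ)
    have key := integral_comp_le_of_continuousMap μ (φ := fun x => x ^ 2)
      (Φ := fun x => δ * x ^ 2) (by fun_prop) (by fun_prop) hle (hgm.indicator hS.compl)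
      (M := ε⁻¹) (fun θ => Set.indicator_nonneg (fun θ _ => hg0 θ) θ)
      (fun θ => Set.indicator_le' (fun θ _ => hgε θ) (fun θ _ => by positivity) θ)
    have h1 : ∫ θ, Sᶜ.indicator g θ ∂haarAddCircle = ∫ θ, g θ ∂haarAddCircle := by
      refine integral_congr_ae ?_
      filter_upwards [hSae] with θ hθ using Set.indicator_of_mem hθ _
    have h2 : ∫ θ, Sᶜ.indicator g θ ^ 2 ∂μ ≤ ∫ θ, g θ ∂haarAddCircle := by
      have h3 : ∀ θ, Sᶜ.indicator g θ ^ 2 = Sᶜ.indicator (fun θ => g θ ^ 2) θ := by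
        intro θ
        by_cases hθ : θ ∈ Sᶜ <;> simp [hθ]
      simp_rw [h3]
      rw [integral_indicator hS.compl, hrestr,
        integral_withDensity_eq_integral_toReal_smul (measurable_density μ) (density_lt_top μ)]
      refine integral_mono_of_nonneg (Eventually.of_forall fun θ => by positivity) hgi
        (Eventually.of_forall fun θ => ?_)
      have hw := ENNReal.toReal_nonneg (a := density μ θ)
      have hpos : 0 < (density μ θ).toReal + ε := by positivity
      change (density μ θ).toReal * (((density μ θ).toReal + ε)⁻¹) ^ 2 ≤
        ((density μ θ).toReal + ε)⁻¹
      rw [inv_pow, ← div_eq_mul_inv, div_le_iff₀ (by positivity), sq,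
        inv_mul_cancel_left₀ hpos.ne']
      linarith
    rw [h1] at key
    have hI0 : 0 ≤ ∫ θ, g θ ∂haarAddCircle := integral_nonneg hg0
    have h5 : δ * (∫ θ, g θ ∂haarAddCircle) ^ 2 ≤ ∫ θ, g θ ∂haarAddCircle := key.trans h2
    rw [← ofReal_integral_eq_lintegral_ofReal hgi (Eventually.of_forall hg0)]
    refine ENNReal.ofReal_le_ofReal ?_
    rcases hI0.eq_or_lt with h0 | hI
    · rw [← h0]
      positivity
    · rw [← one_div, le_div_iff₀ hδ]
      refine le_of_mul_le_mul_right ?_ hI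
      linarith
  -- In `ℝ≥0∞` this also covers `w = 0`, where the limit is `∞`, so Fatou needs no prior positivity
  -- of `w`.
  have hlim : ∀ θ, Tendsto (fun n : ℕ => (density μ θ + ((n : ℝ≥0∞) + 1)⁻¹)⁻¹) atTop
      (𝓝 (density μ θ)⁻¹) := by
    intro θ
    have h1 : Tendsto (fun n : ℕ => ((n : ℝ≥0∞) + 1)⁻¹) atTop (𝓝 0) := by
      have := (ENNReal.tendsto_inv_nat_nhds_zero).comp (tendsto_add_atTop_nat 1)
      simpa [Function.comp_def] using this
    have h2 := (tendsto_const_nhds (x := density μ θ)).add h1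
    rw [add_zero] at h2
    exact tendsto_inv_iff.2 h2
  calc ∫⁻ θ, (density μ θ)⁻¹ ∂haarAddCircle
      = ∫⁻ θ, liminf (fun n : ℕ => (density μ θ + ((n : ℝ≥0∞) + 1)⁻¹)⁻¹) atTop
          ∂haarAddCircle := lintegral_congr fun θ => (hlim θ).liminf_eq.symm
    _ ≤ liminf (fun n : ℕ => ∫⁻ θ, (density μ θ + ((n : ℝ≥0∞) + 1)⁻¹)⁻¹ ∂haarAddCircle) atTop :=
        lintegral_liminf_le fun n => ((measurable_density μ).add_const _).inv
    _ ≤ ENNReal.ofReal δ⁻¹ := by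
        refine liminf_le_of_frequently_le' (Frequently.of_forall fun n => ?_)
        have hε : (0 : ℝ) < ((n : ℝ) + 1)⁻¹ := by positivity
        refine le_trans (lintegral_mono_ae ?_) (hbound _ hε)
        filter_upwards [density_lt_top μ] with θ hθ
        rw [ENNReal.ofReal_inv_of_pos (by positivity), ENNReal.ofReal_add (by positivity) hε.le,
          ENNReal.ofReal_toReal hθ.ne, ENNReal.ofReal_inv_of_pos (by positivity),
          ENNReal.ofReal_add (by positivity) zero_le_one, ENNReal.ofReal_natCast,
          ENNReal.ofReal_one]
    _ < ∞ := ENNReal.ofReal_lt_top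

lemma density_ne_zero_of_lintegral_inv_lt_top
    (h : ∫⁻ θ, (density μ θ)⁻¹ ∂haarAddCircle < ∞) :
    ∀ᵐ θ ∂haarAddCircle, density μ θ ≠ 0 := by
  filter_upwards [ae_lt_top (measurable_density μ).inv h.ne] with θ hθ
  exact ENNReal.inv_ne_top.1 hθ.ne

lemma integrable_inv_toReal_density (h : ∫⁻ θ, (density μ θ)⁻¹ ∂haarAddCircle < ∞) :
    Integrable (fun θ => (density μ θ).toReal⁻¹) haarAddCircle := by
  have := integrable_toReal_of_lintegral_ne_top (measurable_density μ).inv.aemeasurable h.ne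
  simpa only [Pi.inv_apply, ENNReal.toReal_inv] using this

/-- Kolmogorov's criterion, sufficiency. -/
theorem isMinimal_of_lintegral_inv_density_lt_top (hX : IsStationary X P)
    (hμ : IsSpectralMeasure X P μ) (h : ∫⁻ θ, (density μ θ)⁻¹ ∂haarAddCircle < ∞) :
    IsMinimal hX := by
  have := hμ.1
  set w : AddCircle (2 * Real.pi) → ℝ := fun θ => (density μ θ).toReal with hw
  have hwpos : ∀ᵐ θ ∂haarAddCircle, 0 < w θ := by
    filter_upwards [density_ne_zero_of_lintegral_inv_lt_top h, density_lt_top μ] with θ h1 h2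
    exact ENNReal.toReal_pos h1 h2.ne
  have hwi : Integrable (fun θ => (w θ)⁻¹) haarAddCircle := integrable_inv_toReal_density h
  set c : ℝ := ∫ θ, (w θ)⁻¹ ∂haarAddCircle with hc
  have hc0 : 0 ≤ c := integral_nonneg fun θ => by positivity
  intro n hn
  -- A distance bound uniform in `y`. It is a closed condition, so it would extend to `y = X_n`,
  -- where it fails.
  have hlow : ∀ y ∈ Submodule.span ℂ (toL2 hX '' {m | m ≠ n}),
      1 ≤ (c + 1) * ‖toL2 hX n - y‖ ^ 2 := by
    intro y hy
    have himage : toL2 hX '' {m | m ≠ n} = (fun m => toL2 hX (-m)) '' {m | m ≠ -n} := by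
      ext z
      constructor
      · rintro ⟨m, hm, rfl⟩
        exact ⟨-m, fun h => hm (neg_injective h), by simp⟩
      · rintro ⟨m, hm, rfl⟩
        exact ⟨-m, fun h => hm (by rw [← h, neg_neg]), rfl⟩
    rw [himage] at hy
    obtain ⟨l, hl, rfl⟩ := (Finsupp.mem_span_image_iff_linearCombination ℂ).1 hy
    have hln : l (-n) = 0 := by
      by_contra hne
      exact hl (Finsupp.mem_support_iff.2 hne) rfl
    set l' : ℤ →₀ ℂ := Finsupp.single (-n) 1 - l with hl'
    have hsub : toL2 hX n - Finsupp.linearCombination ℂ (fun m => toL2 hX (-m)) l =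
        Finsupp.linearCombination ℂ (fun m => toL2 hX (-m)) l' := by
      rw [hl', map_sub, Finsupp.linearCombination_single, one_smul, neg_neg]
    rw [hsub, norm_sq_linearCombination_toL2 hX hμ]
    set f := Finsupp.linearCombination ℂ (fourier (T := 2 * Real.pi)) l' with hf
    have h1 : 1 ≤ ∫ θ, ‖f θ‖ ∂haarAddCircle := by
      have h2 := integral_fourier_neg_mul_linearCombination l' (-n)
      have h3 : l' (-n) = 1 := by simp [hl', hln]
      rw [h3, ← hf] at h2
      calc (1 : ℝ) = ‖∫ θ, fourier (- -n) θ * f θ ∂haarAddCircle‖ := by rw [h2, norm_one]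
        _ ≤ ∫ θ, ‖fourier (- -n) θ * f θ‖ ∂haarAddCircle := norm_integral_le_integral_norm _
        _ = ∫ θ, ‖f θ‖ ∂haarAddCircle := by
          refine integral_congr_ae (Eventually.of_forall fun θ => ?_)
          simp only [norm_mul, fourier_apply, Circle.norm_coe, one_mul]
    obtain ⟨C, hC⟩ := isCompact_univ.exists_bound_of_continuousOn f.continuous.continuousOn
    have hint : Integrable (fun θ => w θ * ‖f θ‖ ^ 2) haarAddCircle := by
      refine (integrable_toReal_density μ).mul_bdd (c := C ^ 2)
        (by fun_prop) (Eventually.of_forall fun θ => ?_)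
      rw [norm_pow, norm_norm]
      exact pow_le_pow_left₀ (norm_nonneg _) (hC θ trivial) 2
    have h4 : ∫ θ, w θ * ‖f θ‖ ^ 2 ∂haarAddCircle ≤ ∫ θ, ‖f θ‖ ^ 2 ∂μ := by
      have h5 := integral_withDensity_eq_integral_toReal_smul (measurable_density μ)
        (density_lt_top μ) (fun θ => ‖f θ‖ ^ 2)
      simp only [smul_eq_mul] at h5
      rw [← h5]
      exact integral_mono_measure (Measure.withDensity_rnDeriv_le μ haarAddCircle)
        (Eventually.of_forall fun θ => by positivity) (integrable_of_continuous (by fun_prop))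
    -- Cauchy–Schwarz in the form `2|f| ≤ a w|f|² + 1/(a w)` with `a = c + 1`; taking `c + 1`
    -- instead of `c` makes positivity immediate.
    have h6 : 2 * ∫ θ, ‖f θ‖ ∂haarAddCircle ≤
        (c + 1) * ∫ θ, w θ * ‖f θ‖ ^ 2 ∂haarAddCircle + (c + 1)⁻¹ * c := by
      rw [hc, ← hc, ← integral_const_mul, ← integral_const_mul, hc, ← integral_const_mul, ← hc,
        ← integral_add (hint.const_mul _) (hwi.const_mul _)]
      refine integral_mono_ae ((integrable_of_continuous (by fun_prop)).const_mul 2)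
        ((hint.const_mul _).add (hwi.const_mul _)) ?_
      filter_upwards [hwpos] with θ hθ
      have hpos : 0 < (c + 1) * w θ := by positivity
      have hamgm : 0 ≤ ((c + 1) * w θ) * (‖f θ‖ - ((c + 1) * w θ)⁻¹) ^ 2 := by positivity
      have hexp : ((c + 1) * w θ) * (‖f θ‖ - ((c + 1) * w θ)⁻¹) ^ 2 =
          (c + 1) * (w θ * ‖f θ‖ ^ 2) + (c + 1)⁻¹ * (w θ)⁻¹ - 2 * ‖f θ‖ := by
        field_simp
        ring
      change 2 * ‖f θ‖ ≤ (c + 1) * (w θ * ‖f θ‖ ^ 2) + (c + 1)⁻¹ * (w θ)⁻¹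
      linarith
    have h7 : (c + 1)⁻¹ * c ≤ 1 := by
      rw [inv_mul_le_iff₀ (by positivity)]
      linarith
    have h8 := mul_le_mul_of_nonneg_left h4 (by positivity : 0 ≤ c + 1)
    linarith
  have hclosed : IsClosed {y | 1 ≤ (c + 1) * ‖toL2 hX n - y‖ ^ 2} :=
    isClosed_le continuous_const (by fun_prop)
  have hself : 1 ≤ (c + 1) * ‖toL2 hX n - toL2 hX n‖ ^ 2 := closure_minimal hlow hclosed hn
  norm_num at hself

end Kolmogorov

/-! ### Non-determinism implies log-integrability of the density. -/

section Szego

variable {Ω : Type*} [MeasurableSpace Ω] {X : ℤ → Ω → ℂ} {P : Measure Ω}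
  {μ : Measure (AddCircle (2 * Real.pi))}

lemma toAddCircle_mem_span (q : Polynomial ℂ) :
    q.toAddCircle ∈ Submodule.span ℂ
      (fourier (T := 2 * Real.pi) '' {m | m = 0 ∨ -m ∈ Set.Iic (-1)}) := by
  induction q using Polynomial.induction_on' with
  | add p q hp hq =>
    rw [map_add]
    exact Submodule.add_mem _ hp hq
  | monomial n a =>
    rw [Polynomial.toAddCircle_monomial_eq_smul_fourier]
    refine Submodule.smul_mem _ _ (Submodule.subset_span ⟨n, ?_, rfl⟩)
    simp only [Set.mem_ofPred_eq, Set.mem_Iic]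
    omega

lemma integral_toAddCircle (q : Polynomial ℂ) :
    ∫ θ, q.toAddCircle θ ∂haarAddCircle = q.coeff 0 := by
  have h := Polynomial.fourierCoeff_toAddCircle_natCast q 0
  simpa [fourierCoeff] using h

/-- An inequality for the constant coefficient of polynomials, passed to exponentials. -/
lemma mul_exp_integral_re_le [IsFiniteMeasure μ] {δ : ℝ}
    (h : ∀ q : Polynomial ℂ, δ * ‖q.coeff 0‖ ^ 2 ≤ ∫ θ, ‖q.toAddCircle θ‖ ^ 2 ∂μ)
    (g : Polynomial ℂ) :
    δ * Real.exp (2 * ∫ θ, (g.toAddCircle θ).re ∂haarAddCircle) ≤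
      ∫ θ, Real.exp (2 * (g.toAddCircle θ).re) ∂μ := by
  -- Partial sums of `exp g` are polynomials; their constant coefficients tend to `exp (g 0)` and
  -- they converge uniformly on the circle.
  set q : ℕ → Polynomial ℂ := fun K =>
    ∑ k ∈ Finset.range K, ((k.factorial : ℂ)⁻¹) • g ^ k with hq
  have hcoeff : Tendsto (fun K => (q K).coeff 0) atTop (𝓝 (NormedSpace.exp (g.coeff 0))) := by
    have h1 := (NormedSpace.exp_series_hasSum_exp' (𝕂 := ℂ) (g.coeff 0)).tendsto_sum_nat
    refine h1.congr fun K => ?_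
    simp only [hq, Polynomial.finsetSum_coeff, Polynomial.coeff_smul]
    refine Finset.sum_congr rfl fun k _ => ?_
    simp only [Polynomial.coeff_zero_eq_eval_zero, Polynomial.eval_pow]
  have hmap : Tendsto (fun K => (q K).toAddCircle) atTop
      (𝓝 (NormedSpace.exp g.toAddCircle)) := by
    have h1 := (NormedSpace.exp_series_hasSum_exp' (𝕂 := ℂ) g.toAddCircle).tendsto_sum_nat
    refine h1.congr fun K => ?_
    simp only [hq, map_sum, map_smul, map_pow]
  have hlim1 := (hcoeff.norm.pow 2).const_mul δ
  have hlim2 := ((continuous_integral_comp_continuousMap (φ := fun z : ℂ => ‖z‖ ^ 2)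
    (by fun_prop) μ).tendsto _).comp hmap
  have key := le_of_tendsto_of_tendsto' hlim1 hlim2 fun K => h (q K)
  have heval : ∀ θ, (NormedSpace.exp g.toAddCircle) θ = Complex.exp (g.toAddCircle θ) := by
    intro θ
    rw [Complex.exp_eq_exp_ℂ]
    exact NormedSpace.map_exp (ContinuousMap.evalAlgHom ℂ ℂ θ) (continuous_eval_const θ) _
  have hre : ∫ θ, (g.toAddCircle θ).re ∂haarAddCircle = (g.coeff 0).re := by
    rw [← integral_toAddCircle g]
    exact integral_re (integrable_of_continuous g.toAddCircle.continuous)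
  have hsq : ∀ z : ℂ, ‖Complex.exp z‖ ^ 2 = Real.exp (2 * z.re) := by
    intro z
    rw [Complex.norm_exp, ← Real.exp_nat_mul]
    norm_num
  rw [← Complex.exp_eq_exp_ℂ, hsq] at key
  simp only [heval, hsq] at key
  rwa [hre]

/-- Negative frequencies are conjugated away: `Re (c e^{-ikθ}) = Re (conj c · e^{ikθ})`. The free
scalar `c` carries the induction through scalar multiples. -/
lemma exists_toAddCircle_re_eq {p : C(AddCircle (2 * Real.pi), ℂ)}
    (hp : p ∈ Submodule.span ℂ (Set.range (fourier (T := 2 * Real.pi)))) (c : ℂ) :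
    ∃ g : Polynomial ℂ, ∀ θ, (c * p θ).re = (g.toAddCircle θ).re := by
  induction hp using Submodule.span_induction generalizing c with
  | mem x hx =>
    obtain ⟨n, rfl⟩ := hx
    rcases le_total 0 n with hn | hn
    · obtain ⟨k, rfl⟩ := Int.eq_ofNat_of_zero_le hn
      exact ⟨Polynomial.monomial k c, fun θ => by
        rw [Polynomial.toAddCircle_monomial_eq_smul_fourier]; rfl⟩
    · obtain ⟨k, hk⟩ := Int.eq_ofNat_of_zero_le (neg_nonneg.2 hn)
      refine ⟨Polynomial.monomial k (conj c), fun θ => ?_⟩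
      rw [Polynomial.toAddCircle_monomial_eq_smul_fourier, ← hk, ContinuousMap.smul_apply,
        fourier_neg, smul_eq_mul, ← map_mul, Complex.conj_re]
  | zero => exact ⟨0, fun θ => by simp⟩
  | add x y _ _ hx hy =>
    obtain ⟨g, hg⟩ := hx c
    obtain ⟨g', hg'⟩ := hy c
    refine ⟨g + g', fun θ => ?_⟩
    rw [map_add, ContinuousMap.add_apply, ContinuousMap.add_apply, mul_add, Complex.add_re,
      Complex.add_re, hg, hg']
  | smul a x _ hx =>
    obtain ⟨g, hg⟩ := hx (c * a)
    refine ⟨g, fun θ => ?_⟩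
    rw [← hg, ContinuousMap.smul_apply, smul_eq_mul, mul_assoc]

/-- Real parts of polynomials in `e^{iθ}` are dense among real continuous functions, so the
exponential form no longer sees that the past is one-sided. -/
lemma exists_pos_mul_exp_integral_le (hX : IsStationary X P)
    (hμ : IsSpectralMeasure X P μ) (h : toL2 hX 0 ∉ cls hX (Set.Iic (-1))) :
    ∃ δ > 0, ∀ v : C(AddCircle (2 * Real.pi), ℝ),
      δ * Real.exp (∫ θ, v θ ∂haarAddCircle) ≤ ∫ θ, Real.exp (v θ) ∂μ := by
  have := hμ.1
  obtain ⟨δ, hδ, hle⟩ := exists_pos_mul_sq_integral_le hX hμ h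
  have hpoly : ∀ q : Polynomial ℂ, δ * ‖q.coeff 0‖ ^ 2 ≤ ∫ θ, ‖q.toAddCircle θ‖ ^ 2 ∂μ := by
    intro q
    rw [← integral_toAddCircle q]
    exact hle _ (toAddCircle_mem_span q)
  have hclosed : IsClosed {f : C(AddCircle (2 * Real.pi), ℂ) |
      δ * Real.exp (2 * ∫ θ, (f θ).re ∂haarAddCircle) ≤ ∫ θ, Real.exp (2 * (f θ).re) ∂μ} :=
    isClosed_le
      ((Real.continuous_exp.comp ((continuous_integral_comp_continuousMap
        Complex.continuous_re haarAddCircle).const_mul 2)).const_mul δ)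
      (continuous_integral_comp_continuousMap (φ := fun z : ℂ => Real.exp (2 * z.re))
        (by fun_prop) μ)
  have hspan : (Submodule.span ℂ (Set.range (fourier (T := 2 * Real.pi))) :
      Set C(AddCircle (2 * Real.pi), ℂ)) ⊆ {f : C(AddCircle (2 * Real.pi), ℂ) |
      δ * Real.exp (2 * ∫ θ, (f θ).re ∂haarAddCircle) ≤ ∫ θ, Real.exp (2 * (f θ).re) ∂μ} := by
    intro p hp
    obtain ⟨g, hg⟩ := exists_toAddCircle_re_eq hp 1
    simp only [one_mul] at hg
    simp only [Set.mem_ofPred_eq, hg]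
    exact mul_exp_integral_re_le hpoly g
  refine ⟨δ, hδ, fun v => ?_⟩
  set f : C(AddCircle (2 * Real.pi), ℂ) := ⟨fun θ => ((v θ / 2 : ℝ) : ℂ), by fun_prop⟩ with hf
  have hmem : f ∈ (Submodule.span ℂ
      (Set.range (fourier (T := 2 * Real.pi)))).topologicalClosure := by
    rw [span_fourier_closure_eq_top]
    trivial
  have h1 : δ * Real.exp (2 * ∫ θ, (f θ).re ∂haarAddCircle) ≤ ∫ θ, Real.exp (2 * (f θ).re) ∂μ :=
    closure_minimal hspan hclosed hmem
  have h2 : ∀ θ, (f θ).re = v θ / 2 := fun θ => Complex.ofReal_re _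
  simp only [h2] at h1
  rw [integral_div, mul_div_cancel₀ _ two_ne_zero] at h1
  simpa only [mul_div_cancel₀ _ (two_ne_zero (α := ℝ))] using h1

/-- The spectral density of a non-deterministic process is positive almost everywhere and has an
integrable logarithm. -/
theorem integrable_log_density_of_notMem (hX : IsStationary X P)
    (hμ : IsSpectralMeasure X P μ) (h : toL2 hX 0 ∉ cls hX (Set.Iic (-1))) :
    (∀ᵐ θ ∂haarAddCircle, density μ θ ≠ 0) ∧
      Integrable (fun θ => Real.log (density μ θ).toReal) haarAddCircle := by
  have := hμ.1
  obtain ⟨δ, hδ, hle⟩ := exists_pos_mul_exp_integral_le hX hμ h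
  obtain ⟨S, hS, hS0, hrestr⟩ := exists_restrict_compl_eq_withDensity_density μ
  have hSae : ∀ᵐ θ ∂haarAddCircle, θ ∈ Sᶜ := by
    rw [ae_iff]
    simpa using hS0
  set w : AddCircle (2 * Real.pi) → ℝ := fun θ => (density μ θ).toReal with hw
  have hwm : Measurable w := (measurable_density μ).ennreal_toReal
  have hw0 : ∀ θ, 0 ≤ w θ := fun θ => ENNReal.toReal_nonneg
  have hwi : Integrable w haarAddCircle := integrable_toReal_density μ
  set C : ℝ := μ.real S + ∫ θ, (1 + w θ) ∂haarAddCircle with hC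
  -- The test function is `v = -log (max (min w 1) ε)` off `S` and `0` on `S`: nonnegative, bounded,
  -- with `w e^v ≤ 1 + w`. Hence `δ ∫ v ≤ δ exp (∫ v) ≤ C` with `C` independent of `ε`.
  have hbound : ∀ ε : ℝ, 0 < ε → ε ≤ 1 →
      ∫⁻ θ, ENNReal.ofReal (-Real.log (max (min (w θ) 1) ε)) ∂haarAddCircle ≤
        ENNReal.ofReal (C / δ) := by
    intro ε hε hε1
    set g : AddCircle (2 * Real.pi) → ℝ := fun θ => -Real.log (max (min (w θ) 1) ε) with hg
    have hgm : Measurable g := by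
      exact (Real.measurable_log.comp ((hwm.min measurable_const).max measurable_const)).neg
    have hmpos : ∀ θ, 0 < max (min (w θ) 1) ε := fun θ => lt_max_of_lt_right hε
    have hg0 : ∀ θ, 0 ≤ g θ := fun θ => by
      rw [hg, neg_nonneg]
      exact Real.log_nonpos (hmpos θ).le (max_le (min_le_right _ _) hε1)
    have hgε : ∀ θ, g θ ≤ -Real.log ε := fun θ =>
      neg_le_neg (Real.log_le_log hε (le_max_right _ _))
    have hgi : Integrable g haarAddCircle := Integrable.of_bound hgm.aestronglyMeasurable
      (-Real.log ε)
      (Eventually.of_forall fun θ => by rw [Real.norm_of_nonneg (hg0 θ)]; exact hgε θ)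
    have key := integral_comp_le_of_continuousMap μ (φ := Real.exp)
      (Φ := fun x => δ * Real.exp x) (by fun_prop) (by fun_prop) hle (hgm.indicator hS.compl)
      (M := -Real.log ε) (fun θ => Set.indicator_nonneg (fun θ _ => hg0 θ) θ)
      (fun θ => Set.indicator_le' (fun θ _ => hgε θ)
        (fun θ _ => neg_nonneg.2 (Real.log_nonpos hε.le hε1)) θ)
    have h1 : ∫ θ, Sᶜ.indicator g θ ∂haarAddCircle = ∫ θ, g θ ∂haarAddCircle := by
      refine integral_congr_ae ?_
      filter_upwards [hSae] with θ hθ using Set.indicator_of_mem hθ _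
    have hexp : ∀ θ, w θ * Real.exp (g θ) ≤ 1 + w θ := by
      intro θ
      rw [hg, Real.exp_neg, Real.exp_log (hmpos θ), ← div_eq_mul_inv, div_le_iff₀ (hmpos θ)]
      rcases le_total (w θ) 1 with h | h
      · rw [min_eq_left h]
        nlinarith [le_max_left (w θ) ε, hw0 θ, hmpos θ]
      · rw [min_eq_right h, max_eq_left hε1]
        linarith
    have h2 : ∫ θ, Real.exp (Sᶜ.indicator g θ) ∂μ ≤ C := by
      have hint : Integrable (fun θ => Real.exp (Sᶜ.indicator g θ)) μ := by
        refine Integrable.of_bound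
          (Real.measurable_exp.comp (hgm.indicator hS.compl)).aestronglyMeasurable
          (Real.exp (-Real.log ε)) (Eventually.of_forall fun θ => ?_)
        rw [Real.norm_of_nonneg (Real.exp_pos _).le]
        exact Real.exp_le_exp.2 (Set.indicator_le' (fun θ _ => hgε θ)
          (fun θ _ => neg_nonneg.2 (Real.log_nonpos hε.le hε1)) θ)
      rw [← integral_add_compl hS hint, hC]
      refine add_le_add ?_ ?_
      · rw [setIntegral_congr_fun hS (g := fun _ => (1 : ℝ))]
        · simp
        · intro θ hθ
          simp [hθ]
      · rw [setIntegral_congr_fun hS.compl (g := fun θ => Real.exp (g θ)), hrestr,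
          integral_withDensity_eq_integral_toReal_smul (measurable_density μ) (density_lt_top μ)]
        · exact integral_mono_of_nonneg
            (Eventually.of_forall fun θ => mul_nonneg (hw0 θ) (Real.exp_pos _).le)
            ((integrable_const 1).add hwi) (Eventually.of_forall hexp)
        · intro θ hθ
          simp only [Set.indicator_of_mem hθ]
    rw [h1] at key
    have h5 : δ * Real.exp (∫ θ, g θ ∂haarAddCircle) ≤ C := key.trans h2
    rw [← ofReal_integral_eq_lintegral_ofReal hgi (Eventually.of_forall hg0)]
    refine ENNReal.ofReal_le_ofReal ?_
    rw [le_div_iff₀ hδ]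
    nlinarith [Real.add_one_le_exp (∫ θ, g θ ∂haarAddCircle)]
  set F : ℕ → AddCircle (2 * Real.pi) → ℝ≥0∞ := fun n θ =>
    ENNReal.ofReal (-Real.log (max (min (w θ) 1) ((n : ℝ) + 1)⁻¹)) with hF
  have hFm : ∀ n, Measurable (F n) := fun n => by
    exact (Real.measurable_log.comp
      ((hwm.min measurable_const).max measurable_const)).neg.ennreal_ofReal
  have hFatou : ∫⁻ θ, liminf (fun n => F n θ) atTop ∂haarAddCircle ≤ ENNReal.ofReal (C / δ) := by
    refine (lintegral_liminf_le hFm).trans ?_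
    refine liminf_le_of_frequently_le' (Frequently.of_forall fun n => ?_)
    refine hbound _ (by positivity) (inv_le_one_of_one_le₀ ?_)
    linarith [(Nat.cast_nonneg n : (0 : ℝ) ≤ n)]
  have hεlim : Tendsto (fun n : ℕ => ((n : ℝ) + 1)⁻¹) atTop (𝓝 0) := by
    simpa using tendsto_one_div_add_atTop_nhds_zero_nat (𝕜 := ℝ)
  -- Zeros of `w` need their own limit: since `Real.log 0 = 0`, integrability of `Real.log w` alone
  -- would not exclude them.
  have hlim0 : ∀ θ, w θ = 0 → liminf (fun n => F n θ) atTop = ∞ := by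
    intro θ hθ
    refine Tendsto.liminf_eq (ENNReal.tendsto_ofReal_nhds_top.2 ?_)
    have h1 : ∀ n : ℕ, max (min (w θ) 1) ((n : ℝ) + 1)⁻¹ = ((n : ℝ) + 1)⁻¹ := fun n => by
      rw [hθ, min_eq_left zero_le_one, max_eq_right (by positivity)]
    simp only [h1, Real.log_inv, neg_neg]
    exact Real.tendsto_log_atTop.comp
      (tendsto_atTop_add_const_right _ _ tendsto_natCast_atTop_atTop)
  have hlim1 : ∀ θ, 0 < w θ → liminf (fun n => F n θ) atTop =
      ENNReal.ofReal (-Real.log (min (w θ) 1)) := by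
    intro θ hθ
    refine Tendsto.liminf_eq (ENNReal.tendsto_ofReal (Tendsto.neg ?_))
    have h1 : Tendsto (fun n : ℕ => max (min (w θ) 1) ((n : ℝ) + 1)⁻¹) atTop
        (𝓝 (min (w θ) 1)) := by
      have := (tendsto_const_nhds (x := min (w θ) 1)).max hεlim
      rwa [max_eq_left (le_min hθ.le zero_le_one)] at this
    exact h1.log (lt_min hθ zero_lt_one).ne'
  have hfin : ∀ᵐ θ ∂haarAddCircle, liminf (fun n => F n θ) atTop < ∞ :=
    ae_lt_top (Measurable.liminf hFm) (hFatou.trans_lt ENNReal.ofReal_lt_top).ne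
  have hwpos : ∀ᵐ θ ∂haarAddCircle, 0 < w θ := by
    filter_upwards [hfin] with θ hθ
    refine (hw0 θ).lt_of_ne' fun h0 => ?_
    rw [hlim0 θ h0] at hθ
    exact lt_irrefl _ hθ
  refine ⟨?_, ?_⟩
  · filter_upwards [hwpos] with θ hθ h0
    simp [hw, h0] at hθ
  · have hminint : Integrable (fun θ => -Real.log (min (w θ) 1)) haarAddCircle := by
      refine ⟨(Real.measurable_log.comp (hwm.min measurable_const)).neg.aestronglyMeasurable, ?_⟩
      rw [hasFiniteIntegral_iff_ofReal]
      · refine lt_of_le_of_lt ?_ (hFatou.trans_lt ENNReal.ofReal_lt_top)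
        refine lintegral_mono_ae ?_
        filter_upwards [hwpos] with θ hθ
        rw [hlim1 θ hθ]
      · filter_upwards [hwpos] with θ hθ
        exact neg_nonneg.2 (Real.log_nonpos (le_min hθ.le zero_le_one) (min_le_right _ _))
    refine (hminint.add hwi).mono' (Real.measurable_log.comp hwm).aestronglyMeasurable ?_
    filter_upwards [hwpos] with θ hθ
    change |Real.log (w θ)| ≤ -Real.log (min (w θ) 1) + w θ
    rcases le_total (w θ) 1 with h | h
    · rw [min_eq_left h, abs_of_nonpos (Real.log_nonpos hθ.le h)]
      linarith
    · rw [min_eq_right h, Real.log_one, abs_of_nonneg (Real.log_nonneg h)]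
      linarith [Real.log_le_sub_one_of_pos hθ]

lemma integrable_log_density_of_lintegral_inv_lt_top [IsFiniteMeasure μ]
    (h : ∫⁻ θ, (density μ θ)⁻¹ ∂haarAddCircle < ∞) :
    Integrable (fun θ => Real.log (density μ θ).toReal) haarAddCircle := by
  have hwm := (measurable_density μ).ennreal_toReal
  refine ((integrable_inv_toReal_density h).add (integrable_toReal_density μ)).mono'
    (Real.measurable_log.comp hwm).aestronglyMeasurable ?_
  filter_upwards [density_ne_zero_of_lintegral_inv_lt_top h, density_lt_top μ] with θ h1 h2
  have hpos := ENNReal.toReal_pos h1 h2.ne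
  have h3 := Real.log_le_sub_one_of_pos hpos
  have h4 := Real.log_le_sub_one_of_pos (inv_pos.2 hpos)
  have h5 := inv_pos.2 hpos
  rw [Real.log_inv] at h4
  change |Real.log (density μ θ).toReal| ≤ (density μ θ).toReal⁻¹ + (density μ θ).toReal
  rw [abs_le]
  constructor <;> linarith

end Szego

/-! ### Poisson integrals on the circle and their boundary values. -/

section Poisson

lemma norm_fourier_apply (n : ℤ) (θ : AddCircle (2 * Real.pi)) : ‖fourier n θ‖ = 1 := by
  rw [fourier_apply, Circle.norm_coe]

lemma circleAverage_eq_integral_haarAddCircle {E : Type*} [NormedAddCommGroup E] [NormedSpace ℝ E]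
    (f : ℂ → E) (r : ℝ) :
    Real.circleAverage f 0 r =
      ∫ θ : AddCircle (2 * Real.pi), f (r * fourier 1 θ) ∂haarAddCircle := by
  rw [AddCircle.integral_haarAddCircle, Real.circleAverage,
    ← AddCircle.intervalIntegral_preimage (2 * Real.pi) 0, zero_add]
  congr 1
  refine intervalIntegral.integral_congr fun θ _ => ?_
  simp only [circleMap, zero_add, fourier_coe_apply]
  congr 3
  push_cast
  have hpi : (Real.pi : ℂ) ≠ 0 := Complex.ofReal_ne_zero.2 Real.pi_ne_zero
  field_simp

/-- The Poisson kernel on the circle. -/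
noncomputable def poissonCircle (r : ℝ) (t θ : AddCircle (2 * Real.pi)) : ℝ :=
  (1 - r ^ 2) / ‖fourier 1 θ - r * fourier 1 t‖ ^ 2

/-- Both denominators are `1 + r² - 2r cos (θ - t)`. Symmetry lets Fubini integrate the kernel out
in `t`. -/
lemma poissonCircle_symm (r : ℝ) (t θ : AddCircle (2 * Real.pi)) :
    poissonCircle r t θ = poissonCircle r θ t := by
  have h1 : Complex.normSq (fourier 1 θ) = 1 := by
    rw [Complex.normSq_eq_norm_sq, norm_fourier_apply, one_pow]
  have h2 : Complex.normSq (fourier 1 t) = 1 := by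
    rw [Complex.normSq_eq_norm_sq, norm_fourier_apply, one_pow]
  rw [Complex.normSq_apply] at h1 h2
  unfold poissonCircle
  congr 1
  rw [Complex.sq_norm, Complex.sq_norm, Complex.normSq_apply, Complex.normSq_apply]
  simp only [Complex.sub_re, Complex.sub_im, Complex.mul_re, Complex.mul_im, Complex.ofReal_re,
    Complex.ofReal_im, zero_mul, sub_zero, add_zero]
  linear_combination (1 - r ^ 2) * (h1 - h2)

lemma norm_ofReal_mul_fourier {r : ℝ} (h0 : 0 ≤ r) (t : AddCircle (2 * Real.pi)) :
    ‖(r : ℂ) * fourier 1 t‖ = r := by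
  rw [norm_mul, norm_fourier_apply, mul_one, Complex.norm_real, Real.norm_of_nonneg h0]

lemma fourier_sub_ne_zero {z : ℂ} (hz : ‖z‖ < 1) (θ : AddCircle (2 * Real.pi)) :
    fourier 1 θ - z ≠ 0 := by
  intro h
  rw [← sub_eq_zero.1 h, norm_fourier_apply] at hz
  exact lt_irrefl _ hz

lemma poissonCircle_nonneg {r : ℝ} (h0 : 0 ≤ r) (h1 : r < 1) (t θ : AddCircle (2 * Real.pi)) :
    0 ≤ poissonCircle r t θ := by
  have : 0 ≤ 1 - r ^ 2 := by nlinarith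
  unfold poissonCircle
  positivity

lemma continuous_poissonCircle {r : ℝ} (h0 : 0 ≤ r) (h1 : r < 1) :
    Continuous fun p : AddCircle (2 * Real.pi) × AddCircle (2 * Real.pi) =>
      poissonCircle r p.1 p.2 := by
  unfold poissonCircle
  refine Continuous.div (by fun_prop) (by fun_prop) fun p => ?_
  have := fourier_sub_ne_zero ((norm_ofReal_mul_fourier h0 p.1).trans_lt h1) p.2
  positivity

lemma exists_poissonCircle_bound {r : ℝ} (h0 : 0 ≤ r) (h1 : r < 1) :
    ∃ C, ∀ t θ, ‖poissonCircle r t θ‖ ≤ C := by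
  obtain ⟨C, hC⟩ := isCompact_univ.exists_bound_of_continuousOn
    (continuous_poissonCircle h0 h1).continuousOn
  exact ⟨C, fun t θ => hC (t, θ) trivial⟩

lemma re_herglotz_eq_poissonCircle {r : ℝ} (h0 : 0 ≤ r) (t θ : AddCircle (2 * Real.pi)) :
    ((fourier 1 θ + r * fourier 1 t) / (fourier 1 θ - r * fourier 1 t)).re =
      poissonCircle r t θ := by
  have h := congrFun (poissonKernel_eq_re_herglotzRieszKernel (c := 0)
    (w := r * fourier 1 t)) (fourier 1 θ)
  simp only [poissonKernel_def, Function.comp_apply, herglotzRieszKernel_def, sub_zero,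
    norm_fourier_apply, norm_ofReal_mul_fourier h0, one_pow] at h
  exact h.symm

variable {E : Type*} [NormedAddCommGroup E] [NormedSpace ℝ E]

/-- The Poisson integral of a function on the circle, at the point `r e^{it}`. -/
noncomputable def poissonIntegral (r : ℝ) (f : AddCircle (2 * Real.pi) → E)
    (t : AddCircle (2 * Real.pi)) : E :=
  ∫ θ, poissonCircle r t θ • f θ ∂haarAddCircle

lemma integrable_poissonCircle_smul {r : ℝ} (h0 : 0 ≤ r) (h1 : r < 1)
    {f : AddCircle (2 * Real.pi) → E} (hf : Integrable f haarAddCircle)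
    (t : AddCircle (2 * Real.pi)) :
    Integrable (fun θ => poissonCircle r t θ • f θ) haarAddCircle := by
  obtain ⟨C, hC⟩ := exists_poissonCircle_bound h0 h1
  exact hf.bdd_smul C
    ((continuous_poissonCircle h0 h1).comp (by fun_prop : Continuous fun θ => (t, θ))
      |>.aestronglyMeasurable) (Eventually.of_forall fun θ => hC t θ)

lemma integrable_prod_poissonCircle_smul {r : ℝ} (h0 : 0 ≤ r) (h1 : r < 1)
    {f : AddCircle (2 * Real.pi) → E} (hf : Integrable f haarAddCircle) :
    Integrable (fun p : AddCircle (2 * Real.pi) × AddCircle (2 * Real.pi) =>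
      poissonCircle r p.1 p.2 • f p.2) (haarAddCircle.prod haarAddCircle) := by
  obtain ⟨C, hC⟩ := exists_poissonCircle_bound h0 h1
  exact (hf.comp_snd haarAddCircle).bdd_smul C
    (continuous_poissonCircle h0 h1).aestronglyMeasurable
    (Eventually.of_forall fun p => hC p.1 p.2)

lemma integrable_poissonIntegral {r : ℝ} (h0 : 0 ≤ r) (h1 : r < 1)
    {f : AddCircle (2 * Real.pi) → E} (hf : Integrable f haarAddCircle) :
    Integrable (poissonIntegral r f) haarAddCircle :=
  (integrable_prod_poissonCircle_smul h0 h1 hf).integral_prod_left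

lemma poissonIntegral_sub {r : ℝ} (h0 : 0 ≤ r) (h1 : r < 1)
    {f g : AddCircle (2 * Real.pi) → E} (hf : Integrable f haarAddCircle)
    (hg : Integrable g haarAddCircle) (t : AddCircle (2 * Real.pi)) :
    poissonIntegral r (fun θ => f θ - g θ) t = poissonIntegral r f t - poissonIntegral r g t := by
  unfold poissonIntegral
  simp_rw [smul_sub]
  exact integral_sub (integrable_poissonCircle_smul h0 h1 hf t)
    (integrable_poissonCircle_smul h0 h1 hg t)

lemma poissonIntegral_fourier_natCast {r : ℝ} (h0 : 0 ≤ r) (h1 : r < 1) (n : ℕ)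
    (t : AddCircle (2 * Real.pi)) :
    poissonIntegral r (fourier (n : ℤ)) t = (r : ℂ) ^ n * fourier (n : ℤ) t := by
  have hpow : ∀ θ : AddCircle (2 * Real.pi), fourier (n : ℤ) θ = fourier 1 θ ^ n := by
    intro θ
    rw [fourier_apply, fourier_one, natCast_zsmul, AddCircle.toCircle_nsmul, Circle.coe_pow]
  have hd : DiffContOnCl ℂ (fun z : ℂ => z ^ n) (Metric.ball 0 1) :=
    (differentiable_pow n).diffContOnCl
  have hmem : (r : ℂ) * fourier 1 t ∈ Metric.ball (0 : ℂ) 1 := by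
    rw [mem_ball_zero_iff, norm_ofReal_mul_fourier h0]
    exact h1
  have h := hd.circleAverage_poissonKernel_smul' hmem
  rw [circleAverage_eq_integral_haarAddCircle] at h
  simp only [Complex.ofReal_one, one_mul, sub_zero, norm_fourier_apply,
    norm_ofReal_mul_fourier h0, one_pow] at h
  rw [hpow, ← mul_pow, ← h]
  refine integral_congr_ae (Eventually.of_forall fun θ => ?_)
  simp only [hpow]
  rfl

lemma poissonIntegral_fourier {r : ℝ} (h0 : 0 ≤ r) (h1 : r < 1) (n : ℤ)
    (t : AddCircle (2 * Real.pi)) :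
    poissonIntegral r (fourier n) t = (r : ℂ) ^ n.natAbs * fourier n t := by
  rcases le_total 0 n with hn | hn
  · obtain ⟨k, rfl⟩ := Int.eq_ofNat_of_zero_le hn
    exact poissonIntegral_fourier_natCast h0 h1 k t
  · obtain ⟨k, hk⟩ := Int.eq_ofNat_of_zero_le (neg_nonneg.2 hn)
    obtain rfl : n = -k := by omega
    have h := congrArg conj (poissonIntegral_fourier_natCast h0 h1 k t)
    rw [map_mul, map_pow, Complex.conj_ofReal, ← fourier_neg, poissonIntegral,
      ← integral_conj] at h
    rw [Int.natAbs_neg, Int.natAbs_natCast, ← h]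
    refine integral_congr_ae (Eventually.of_forall fun θ => ?_)
    simp only [Complex.real_smul, map_mul, Complex.conj_ofReal, fourier_neg]

lemma integral_poissonCircle {r : ℝ} (h0 : 0 ≤ r) (h1 : r < 1) (t : AddCircle (2 * Real.pi)) :
    ∫ θ, poissonCircle r t θ ∂haarAddCircle = 1 := by
  have h := poissonIntegral_fourier_natCast h0 h1 0 t
  simp only [poissonIntegral, Nat.cast_zero, fourier_zero, Complex.real_smul, mul_one,
    pow_zero] at h
  rw [integral_complex_ofReal] at h
  exact_mod_cast h

lemma integral_poissonIntegral [CompleteSpace E] {r : ℝ} (h0 : 0 ≤ r) (h1 : r < 1)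
    {f : AddCircle (2 * Real.pi) → E} (hf : Integrable f haarAddCircle) :
    ∫ t, poissonIntegral r f t ∂haarAddCircle = ∫ θ, f θ ∂haarAddCircle := by
  unfold poissonIntegral
  rw [integral_integral_swap (integrable_prod_poissonCircle_smul h0 h1 hf)]
  refine integral_congr_ae (Eventually.of_forall fun θ => ?_)
  simp only [integral_smul_const, poissonCircle_symm r _ θ, integral_poissonCircle h0 h1, one_smul]

lemma norm_poissonIntegral_le {r : ℝ} (h0 : 0 ≤ r) (h1 : r < 1)
    (f : AddCircle (2 * Real.pi) → E) (t : AddCircle (2 * Real.pi)) :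
    ‖poissonIntegral r f t‖ ≤ poissonIntegral r (fun θ => ‖f θ‖) t := by
  refine (norm_integral_le_integral_norm _).trans_eq ?_
  refine integral_congr_ae (Eventually.of_forall fun θ => ?_)
  simp only [norm_smul, Real.norm_of_nonneg (poissonCircle_nonneg h0 h1 t θ), smul_eq_mul]

lemma integral_norm_poissonIntegral_le {r : ℝ} (h0 : 0 ≤ r) (h1 : r < 1)
    {f : AddCircle (2 * Real.pi) → E} (hf : Integrable f haarAddCircle) :
    ∫ t, ‖poissonIntegral r f t‖ ∂haarAddCircle ≤ ∫ θ, ‖f θ‖ ∂haarAddCircle := by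
  rw [← integral_poissonIntegral h0 h1 hf.norm]
  exact integral_mono (integrable_poissonIntegral h0 h1 hf).norm
    (integrable_poissonIntegral h0 h1 hf.norm) (norm_poissonIntegral_le h0 h1 f)

lemma tendsto_poissonIntegral_of_mem_span {r : ℕ → ℝ} (h0 : ∀ n, 0 ≤ r n) (h1 : ∀ n, r n < 1)
    (hr : Tendsto r atTop (𝓝 1)) {p : C(AddCircle (2 * Real.pi), ℂ)}
    (hp : p ∈ Submodule.span ℂ (Set.range (fourier (T := 2 * Real.pi))))
    (t : AddCircle (2 * Real.pi)) :
    Tendsto (fun n => poissonIntegral (r n) p t) atTop (𝓝 (p t)) := by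
  induction hp using Submodule.span_induction with
  | mem x hx =>
    obtain ⟨m, rfl⟩ := hx
    simp only [poissonIntegral_fourier (h0 _) (h1 _)]
    have h2 := (((Complex.continuous_ofReal.tendsto 1).comp hr).pow m.natAbs).mul_const
      (fourier m t)
    simpa using h2
  | zero => simp [poissonIntegral]
  | add x y _ _ hx hy =>
    refine (hx.add hy).congr fun n => ?_
    simp only [poissonIntegral, ContinuousMap.add_apply, smul_add]
    exact (integral_add
      (integrable_poissonCircle_smul (h0 n) (h1 n) (integrable_of_continuous x.continuous) t)
      (integrable_poissonCircle_smul (h0 n) (h1 n)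
        (integrable_of_continuous y.continuous) t)).symm
  | smul a x _ hx =>
    refine (hx.const_mul a).congr fun n => ?_
    simp only [poissonIntegral, ContinuousMap.smul_apply, smul_eq_mul, ← integral_const_mul,
      mul_smul_comm]

lemma exists_mem_span_integral_norm_sub_le {f : AddCircle (2 * Real.pi) → ℂ}
    (hf : Integrable f haarAddCircle) {ε : ℝ} (hε : 0 < ε) :
    ∃ p ∈ Submodule.span ℂ (Set.range (fourier (T := 2 * Real.pi))),
      ∫ θ, ‖f θ - p θ‖ ∂haarAddCircle ≤ ε := by
  obtain ⟨g, hg, -⟩ := hf.exists_boundedContinuous_integral_sub_le (half_pos hε)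
  have hmem : g.toContinuousMap ∈ closure (Submodule.span ℂ
      (Set.range (fourier (T := 2 * Real.pi))) : Set C(AddCircle (2 * Real.pi), ℂ)) := by
    rw [← Submodule.topologicalClosure_coe, span_fourier_closure_eq_top]
    trivial
  obtain ⟨p, hp, hgp⟩ := Metric.mem_closure_iff.1 hmem (ε / 2) (half_pos hε)
  refine ⟨p, hp, ?_⟩
  have hgi : Integrable g haarAddCircle := integrable_of_continuous g.continuous
  have hpi : Integrable p haarAddCircle := integrable_of_continuous p.continuous
  calc ∫ θ, ‖f θ - p θ‖ ∂haarAddCircle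
      ≤ ∫ θ, (‖f θ - g θ‖ + ε / 2) ∂haarAddCircle := by
        refine integral_mono (hf.sub hpi).norm ((hf.sub hgi).norm.add (integrable_const _))
          fun θ => ?_
        refine (norm_sub_le_norm_sub_add_norm_sub (f θ) (g θ) (p θ)).trans ?_
        gcongr
        exact (ContinuousMap.norm_coe_le_norm (g.toContinuousMap - p) θ).trans
          (by rw [← dist_eq_norm]; exact hgp.le)
    _ = ∫ θ, ‖f θ - g θ‖ ∂haarAddCircle + ε / 2 := by
        refine (integral_add (hf.sub hgi).norm (integrable_const _)).trans ?_
        simp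
    _ ≤ ε := by linarith

/-- Poisson integrals converge in `L¹` at the boundary. -/
theorem tendsto_integral_norm_poissonIntegral_sub {r : ℕ → ℝ} (h0 : ∀ n, 0 ≤ r n)
    (h1 : ∀ n, r n < 1) (hr : Tendsto r atTop (𝓝 1)) {f : AddCircle (2 * Real.pi) → ℂ}
    (hf : Integrable f haarAddCircle) :
    Tendsto (fun n => ∫ t, ‖poissonIntegral (r n) f t - f t‖ ∂haarAddCircle) atTop (𝓝 0) := by
  rw [Metric.tendsto_atTop]
  intro ε hε
  -- On `p` the Poisson integral multiplies the frequency `n` by `r^|n|`; on `f - p` it is an `L¹`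
  -- contraction.
  obtain ⟨p, hp, hfp⟩ := exists_mem_span_integral_norm_sub_le hf (by positivity : 0 < ε / 4)
  have hpi : Integrable p haarAddCircle := integrable_of_continuous p.continuous
  have hPp : ∀ n, Integrable (poissonIntegral (r n) p) haarAddCircle := fun n =>
    integrable_poissonIntegral (h0 n) (h1 n) hpi
  have hlim : Tendsto (fun n => ∫ t, ‖poissonIntegral (r n) p t - p t‖ ∂haarAddCircle) atTop
      (𝓝 0) := by
    have h2 : Tendsto (fun n => ∫ t, ‖poissonIntegral (r n) p t - p t‖ ∂haarAddCircle) atTop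
        (𝓝 (∫ t : AddCircle (2 * Real.pi), (0 : ℝ) ∂haarAddCircle)) := by
      refine tendsto_integral_of_dominated_convergence (fun _ => ‖p‖ + ‖p‖)
        (fun n => ((hPp n).sub hpi).norm.aestronglyMeasurable) (integrable_const _)
        (fun n => Eventually.of_forall fun t => ?_) (Eventually.of_forall fun t => ?_)
      · rw [norm_norm]
        refine (norm_sub_le _ _).trans (add_le_add ?_ (p.norm_coe_le_norm t))
        refine (norm_poissonIntegral_le (h0 n) (h1 n) p t).trans ?_
        calc poissonIntegral (r n) (fun θ => ‖p θ‖) t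
            ≤ ∫ θ, poissonCircle (r n) t θ • ‖p‖ ∂haarAddCircle := by
              refine integral_mono (integrable_poissonCircle_smul (h0 n) (h1 n) hpi.norm t)
                (integrable_poissonCircle_smul (h0 n) (h1 n) (integrable_const _) t) fun θ => ?_
              exact mul_le_mul_of_nonneg_left (p.norm_coe_le_norm θ)
                (poissonCircle_nonneg (h0 n) (h1 n) t θ)
          _ = ‖p‖ := by
              rw [integral_smul_const, integral_poissonCircle (h0 n) (h1 n), one_smul]
      · have h3 := (tendsto_poissonIntegral_of_mem_span h0 h1 hr hp t).sub_const (p t)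
        rw [sub_self] at h3
        simpa using h3.norm
    simpa using h2
  obtain ⟨N, hN⟩ := (Metric.tendsto_atTop.1 hlim) (ε / 4) (by positivity)
  refine ⟨N, fun n hn => ?_⟩
  have h4 := hN n hn
  rw [dist_zero_right, Real.norm_of_nonneg (integral_nonneg fun _ => norm_nonneg _)] at h4 ⊢
  have hfpi : Integrable (fun θ => f θ - p θ) haarAddCircle := hf.sub hpi
  have hPfp := integrable_poissonIntegral (h0 n) (h1 n) hfpi
  have h5 := integral_norm_poissonIntegral_le (h0 n) (h1 n) hfpi
  calc ∫ t, ‖poissonIntegral (r n) f t - f t‖ ∂haarAddCircle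
      ≤ ∫ t, (‖poissonIntegral (r n) (fun θ => f θ - p θ) t‖ +
          ‖poissonIntegral (r n) p t - p t‖ + ‖f t - p t‖) ∂haarAddCircle := by
        refine integral_mono ((integrable_poissonIntegral (h0 n) (h1 n) hf).sub hf).norm
          ((hPfp.norm.add ((hPp n).sub hpi).norm).add hfpi.norm) fun t => ?_
        have h6 : poissonIntegral (r n) f t - f t =
            poissonIntegral (r n) (fun θ => f θ - p θ) t +
              (poissonIntegral (r n) p t - p t) - (f t - p t) := by
          rw [poissonIntegral_sub (h0 n) (h1 n) hf hpi]
          ring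
        change ‖poissonIntegral (r n) f t - f t‖ ≤ _
        rw [h6]
        exact (norm_sub_le _ _).trans (by gcongr; exact norm_add_le _ _)
    _ = ∫ t, ‖poissonIntegral (r n) (fun θ => f θ - p θ) t‖ ∂haarAddCircle +
          ∫ t, ‖poissonIntegral (r n) p t - p t‖ ∂haarAddCircle +
          ∫ t, ‖f t - p t‖ ∂haarAddCircle := by
        refine (integral_add (hPfp.norm.add ((hPp n).sub hpi).norm) hfpi.norm).trans ?_
        congr 1
        exact integral_add hPfp.norm ((hPp n).sub hpi).norm
    _ < ε := by linarith

/-- Along a sequence of radii, the Poisson integrals of a real integrable function converge to it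
almost everywhere. -/
theorem exists_seq_tendsto_poissonIntegral_ae {ψ : AddCircle (2 * Real.pi) → ℝ}
    (hψ : Integrable ψ haarAddCircle) :
    ∃ r : ℕ → ℝ, (∀ n, 0 ≤ r n ∧ r n < 1) ∧ ∀ᵐ t ∂haarAddCircle,
      Tendsto (fun n => poissonIntegral (r n) ψ t) atTop (𝓝 (ψ t)) := by
  set r : ℕ → ℝ := fun n => 1 - 1 / ((n : ℝ) + 1) with hr
  have hle : ∀ n : ℕ, 1 / ((n : ℝ) + 1) ≤ 1 := fun n => by
    rw [div_le_one (by positivity)]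
    linarith [(Nat.cast_nonneg n : (0 : ℝ) ≤ n)]
  have h0 : ∀ n, 0 ≤ r n := fun n => by linarith [hle n]
  have h1 : ∀ n, r n < 1 := fun n => by
    have : (0 : ℝ) < 1 / ((n : ℝ) + 1) := by positivity
    linarith
  have hlim : Tendsto r atTop (𝓝 1) := by
    simpa [hr] using (tendsto_one_div_add_atTop_nhds_zero_nat (𝕜 := ℝ)).const_sub 1
  have hψc : Integrable (fun t => (ψ t : ℂ)) haarAddCircle := hψ.ofReal
  have hL1 := tendsto_integral_norm_poissonIntegral_sub h0 h1 hlim hψc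
  have hcast : ∀ n t, poissonIntegral (r n) (fun t => (ψ t : ℂ)) t =
      ((poissonIntegral (r n) ψ t : ℝ) : ℂ) := by
    intro n t
    rw [poissonIntegral, poissonIntegral, ← integral_complex_ofReal]
    simp
  have heL : Tendsto (fun n => eLpNorm (poissonIntegral (r n) ψ - ψ) 1 haarAddCircle) atTop
      (𝓝 0) := by
    have h2 := ENNReal.tendsto_ofReal hL1
    rw [ENNReal.ofReal_zero] at h2
    refine h2.congr fun n => ?_
    have hi := (integrable_poissonIntegral (h0 n) (h1 n) hψ).sub hψ
    rw [eLpNorm_one_eq_lintegral_enorm, ← ofReal_integral_norm_eq_lintegral_enorm hi]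
    congr 1
    refine integral_congr_ae (Eventually.of_forall fun t => ?_)
    simp only [hcast, ← Complex.ofReal_sub, Complex.norm_real, Pi.sub_apply]
  -- A subsequence is enough for the later use of Fatou, so no theorem on radial limits is needed.
  obtain ⟨ns, -, hns⟩ := (tendstoInMeasure_of_tendsto_eLpNorm one_ne_zero
    (fun n => (integrable_poissonIntegral (h0 n) (h1 n) hψ).aestronglyMeasurable)
    hψ.aestronglyMeasurable heL).exists_seq_tendsto_ae
  exact ⟨fun n => r (ns n), fun n => ⟨h0 _, h1 _⟩, hns⟩

/-- Jensen's inequality for Poisson integrals and the exponential function. -/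
lemma exp_poissonIntegral_le {r : ℝ} (h0 : 0 ≤ r) (h1 : r < 1)
    {ψ : AddCircle (2 * Real.pi) → ℝ} (hψ : Integrable ψ haarAddCircle)
    (hexp : Integrable (fun θ => Real.exp (ψ θ)) haarAddCircle) (t : AddCircle (2 * Real.pi)) :
    Real.exp (poissonIntegral r ψ t) ≤ poissonIntegral r (fun θ => Real.exp (ψ θ)) t := by
  set y := poissonIntegral r ψ t with hy
  have hi := integrable_poissonCircle_smul h0 h1 hψ t
  have hc := integrable_poissonCircle_smul h0 h1
    (integrable_const (1 - y) : Integrable _ haarAddCircle) t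
  -- The tangent line of `exp` at `y`, namely `e^y (1 - y + x) ≤ e^x`, is integrated against the
  -- probability kernel.
  calc Real.exp y = Real.exp y * (∫ θ, poissonCircle r t θ • (1 - y) ∂haarAddCircle +
        ∫ θ, poissonCircle r t θ • ψ θ ∂haarAddCircle) := by
        rw [integral_smul_const, integral_poissonCircle h0 h1]
        change Real.exp y = Real.exp y * (1 • (1 - y) + y)
        simp
    _ = ∫ θ, Real.exp y * (poissonCircle r t θ • (1 - y) + poissonCircle r t θ • ψ θ)
          ∂haarAddCircle := by
        rw [integral_const_mul, integral_add hc hi]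
    _ ≤ poissonIntegral r (fun θ => Real.exp (ψ θ)) t := by
        refine integral_mono ((hc.add hi).const_mul _)
          (integrable_poissonCircle_smul h0 h1 hexp t) fun θ => ?_
        have hK := poissonCircle_nonneg h0 h1 t θ
        have h2 : Real.exp y * (1 - y + ψ θ) ≤ Real.exp (ψ θ) := by
          have h3 := Real.add_one_le_exp (ψ θ - y)
          calc Real.exp y * (1 - y + ψ θ) ≤ Real.exp y * Real.exp (ψ θ - y) := by
                gcongr
                linarith
            _ = Real.exp (ψ θ) := by rw [← Real.exp_add]; ring_nf
        change Real.exp y * (poissonCircle r t θ * (1 - y) + poissonCircle r t θ * ψ θ) ≤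
          poissonCircle r t θ * Real.exp (ψ θ)
        calc Real.exp y * (poissonCircle r t θ * (1 - y) + poissonCircle r t θ * ψ θ)
            = poissonCircle r t θ * (Real.exp y * (1 - y + ψ θ)) := by ring
          _ ≤ _ := mul_le_mul_of_nonneg_left h2 hK

end Poisson

/-! ### The Szegő function and the Hardy space criterion. -/

section SzegoFunction

lemma continuous_herglotz {z : ℂ} (hz : ‖z‖ < 1) :
    Continuous fun θ : AddCircle (2 * Real.pi) => (fourier 1 θ + z) / (fourier 1 θ - z) :=
  Continuous.div (by fun_prop) (by fun_prop) (fourier_sub_ne_zero hz)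

lemma integrable_herglotz_mul {ψ : AddCircle (2 * Real.pi) → ℂ} (hψ : Integrable ψ haarAddCircle)
    {z : ℂ} (hz : ‖z‖ < 1) :
    Integrable (fun θ => (fourier 1 θ + z) / (fourier 1 θ - z) * ψ θ) haarAddCircle := by
  obtain ⟨C, hC⟩ := isCompact_univ.exists_bound_of_continuousOn
    (continuous_herglotz hz).continuousOn
  exact hψ.bdd_mul (continuous_herglotz hz).aestronglyMeasurable
    (Eventually.of_forall fun θ => hC θ trivial)

lemma differentiableOn_integral_herglotz {ψ : AddCircle (2 * Real.pi) → ℂ}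
    (hψ : Integrable ψ haarAddCircle) :
    DifferentiableOn ℂ (fun z => ∫ θ, (fourier 1 θ + z) / (fourier 1 θ - z) * ψ θ ∂haarAddCircle)
      (Metric.ball 0 1) := by
  intro z₀ hz₀
  rw [mem_ball_zero_iff] at hz₀
  -- Half the distance to the circle: every `z` in the `d`-ball about `z₀` stays `d` away from the
  -- circle, so the derivative of the kernel is at most `2/d²`.
  set d : ℝ := (1 - ‖z₀‖) / 2 with hd
  have hd0 : 0 < d := by linarith
  have hball : ∀ z ∈ Metric.ball z₀ d, ‖z‖ < 1 - d := by
    intro z hz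
    rw [mem_ball_iff_norm] at hz
    have := norm_le_norm_add_norm_sub' z z₀
    linarith
  have hdist : ∀ z ∈ Metric.ball z₀ d, ∀ θ : AddCircle (2 * Real.pi), d ≤ ‖fourier 1 θ - z‖ := by
    intro z hz θ
    have h1 := norm_sub_norm_le (fourier 1 θ) z
    rw [norm_fourier_apply] at h1
    linarith [hball z hz]
  refine DifferentiableAt.differentiableWithinAt (HasDerivAt.differentiableAt
    (hasDerivAt_integral_of_dominated_loc_of_deriv_le
      (F' := fun z θ => 2 * fourier 1 θ / (fourier 1 θ - z) ^ 2 * ψ θ)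
      (bound := fun θ => 2 / d ^ 2 * ‖ψ θ‖) (Metric.ball_mem_nhds z₀ hd0) ?_
      (integrable_herglotz_mul hψ hz₀) ?_ ?_ (hψ.norm.const_mul _) ?_).2)
  · filter_upwards [Metric.ball_mem_nhds z₀ hd0] with z hz
    exact (integrable_herglotz_mul hψ ((hball z hz).trans (by linarith))).aestronglyMeasurable
  · refine AEStronglyMeasurable.mul (Continuous.aestronglyMeasurable ?_) hψ.aestronglyMeasurable
    exact Continuous.div (by fun_prop) (by fun_prop)
      fun θ => pow_ne_zero 2 (fourier_sub_ne_zero hz₀ θ)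
  · refine Eventually.of_forall fun θ z hz => ?_
    rw [norm_mul, norm_div, norm_mul, norm_pow, norm_fourier_apply, mul_one, Complex.norm_ofNat]
    gcongr
    exact hdist z hz θ
  · refine Eventually.of_forall fun θ z hz => ?_
    have hne := fourier_sub_ne_zero ((hball z hz).trans (by linarith)) θ
    have h3 := (((hasDerivAt_id' z).const_add (fourier 1 θ)).div
      ((hasDerivAt_id' z).const_sub (fourier 1 θ)) hne).mul_const (ψ θ)
    refine h3.congr_deriv ?_
    congr 2
    ring

variable {μ : Measure (AddCircle (2 * Real.pi))}

lemma differentiableOn_one_div_szegoFunction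
    (hlog : Integrable (fun θ => Real.log (density μ θ).toReal) haarAddCircle) :
    DifferentiableOn ℂ (fun z => 1 / szegoFunction μ z) (Metric.ball 0 1) := by
  unfold szegoFunction
  exact (differentiableOn_const _).div
    (((differentiableOn_integral_herglotz hlog.ofReal).const_mul _).cexp)
    fun z _ => Complex.exp_ne_zero _

/-- The real part of the Herglotz kernel is the Poisson kernel, and squaring cancels the factor
`1/2` in the exponent of `h`. -/
lemma norm_one_div_szegoFunction_rpow
    (hlog : Integrable (fun θ => Real.log (density μ θ).toReal) haarAddCircle) {r : ℝ}
    (h0 : 0 ≤ r) (h1 : r < 1) (t : AddCircle (2 * Real.pi)) :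
    ‖1 / szegoFunction μ (r * fourier 1 t)‖ ^ (2 : ℝ) =
      Real.exp (poissonIntegral r (fun θ => -Real.log (density μ θ).toReal) t) := by
  have hz : ‖(r : ℂ) * fourier 1 t‖ < 1 := (norm_ofReal_mul_fourier h0 t).trans_lt h1
  have hre : (∫ θ, (fourier 1 θ + r * fourier 1 t) / (fourier 1 θ - r * fourier 1 t) *
      (Real.log (density μ θ).toReal : ℂ) ∂haarAddCircle).re =
      ∫ θ, poissonCircle r t θ * Real.log (density μ θ).toReal ∂haarAddCircle := by
    have h2 := integral_re (𝕜 := ℂ) (integrable_herglotz_mul hlog.ofReal hz)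
    refine h2.symm.trans (integral_congr_ae (Eventually.of_forall fun θ => ?_))
    simp only [← re_herglotz_eq_poissonCircle h0]
    exact Complex.re_mul_ofReal _ _
  rw [szegoFunction, norm_div, norm_one, Complex.norm_exp, one_div, ← Real.exp_neg,
    ← Real.exp_mul]
  congr 1
  have h3 : ∀ z : ℂ, ((1 / 2 : ℂ) * z).re = z.re / 2 := fun z => by
    simp [Complex.mul_re]
    ring
  rw [h3, hre, poissonIntegral]
  simp only [smul_eq_mul, mul_neg, integral_neg]
  ring

lemma inv_density_eq_ofReal_exp {x : ℝ≥0∞} (h0 : x ≠ 0) (htop : x < ∞) :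
    x⁻¹ = ENNReal.ofReal (Real.exp (-Real.log x.toReal)) := by
  have hpos := ENNReal.toReal_pos h0 htop.ne
  rw [Real.exp_neg, Real.exp_log hpos, ENNReal.ofReal_inv_of_pos hpos,
    ENNReal.ofReal_toReal htop.ne]

/-- Jensen bounds `|1/h|²` by the Poisson integral of `1/w`, whose mean on every circle is `∫ 1/w`.
-/
theorem memHardy_one_div_szegoFunction [IsFiniteMeasure μ]
    (h : ∫⁻ θ, (density μ θ)⁻¹ ∂haarAddCircle < ∞) :
    MemHardy 2 (fun z => 1 / szegoFunction μ z) := by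
  have hlog := integrable_log_density_of_lintegral_inv_lt_top h
  refine ⟨differentiableOn_one_div_szegoFunction hlog,
    (∫ θ, (density μ θ).toReal⁻¹ ∂haarAddCircle) ^ (1 / (2 : ℝ)), fun r h0 h1 => ?_⟩
  rw [circleAverage_eq_integral_haarAddCircle]
  have hψ : Integrable (fun θ => -Real.log (density μ θ).toReal) haarAddCircle := hlog.neg
  have hae : (fun θ => (density μ θ).toReal⁻¹) =ᵐ[haarAddCircle]
      fun θ => Real.exp (-Real.log (density μ θ).toReal) := by
    filter_upwards [density_ne_zero_of_lintegral_inv_lt_top h, density_lt_top μ] with θ h2 h3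
    rw [Real.exp_neg, Real.exp_log (ENNReal.toReal_pos h2 h3.ne)]
  have hexp : Integrable (fun θ => Real.exp (-Real.log (density μ θ).toReal)) haarAddCircle :=
    (integrable_inv_toReal_density h).congr hae
  refine Real.rpow_le_rpow (integral_nonneg fun _ => by positivity) ?_ (by norm_num)
  rw [integral_congr_ae hae, ← integral_poissonIntegral h0 h1 hexp]
  refine integral_mono_of_nonneg (Eventually.of_forall fun _ => by positivity)
    (integrable_poissonIntegral h0 h1 hexp) (Eventually.of_forall fun t => ?_)
  simp only [norm_one_div_szegoFunction_rpow hlog h0 h1]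
  exact exp_poissonIntegral_le h0 h1 hψ hexp t

/-- `|1/h|²` tends a.e. to `1/w` along suitable radii, and Fatou applies. `hne` is needed because
`Real.log 0 = 0` makes a zero of `w` look like the value `1`. -/
theorem lintegral_inv_density_lt_top_of_memHardy [IsFiniteMeasure μ]
    (hne : ∀ᵐ θ ∂haarAddCircle, density μ θ ≠ 0)
    (hlog : Integrable (fun θ => Real.log (density μ θ).toReal) haarAddCircle)
    (h : MemHardy 2 (fun z => 1 / szegoFunction μ z)) :
    ∫⁻ θ, (density μ θ)⁻¹ ∂haarAddCircle < ∞ := by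
  obtain ⟨hd, C, hC⟩ := h
  have hψ : Integrable (fun θ => -Real.log (density μ θ).toReal) haarAddCircle := hlog.neg
  obtain ⟨r, hr, hlim⟩ := exists_seq_tendsto_poissonIntegral_ae hψ
  set F : ℕ → AddCircle (2 * Real.pi) → ℝ := fun n t =>
    ‖1 / szegoFunction μ (r n * fourier 1 t)‖ ^ (2 : ℝ) with hF
  have hFcont : ∀ n, Continuous (F n) := by
    intro n
    have h2 : Continuous fun t : AddCircle (2 * Real.pi) =>
        1 / szegoFunction μ (r n * fourier 1 t) :=
      hd.continuousOn.comp_continuous (by fun_prop) fun t => by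
        rw [mem_ball_zero_iff, norm_ofReal_mul_fourier (hr n).1]
        exact (hr n).2
    exact h2.norm.rpow_const fun _ => Or.inr (by norm_num)
  calc ∫⁻ θ, (density μ θ)⁻¹ ∂haarAddCircle
      = ∫⁻ θ, liminf (fun n => ENNReal.ofReal (F n θ)) atTop ∂haarAddCircle := by
        refine lintegral_congr_ae ?_
        filter_upwards [hne, density_lt_top μ, hlim] with θ h2 h3 h4
        rw [inv_density_eq_ofReal_exp h2 h3]
        refine (Tendsto.liminf_eq (ENNReal.tendsto_ofReal ?_)).symm
        simp only [hF, norm_one_div_szegoFunction_rpow hlog (hr _).1 (hr _).2]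
        exact (Real.continuous_exp.tendsto _).comp h4
    _ ≤ liminf (fun n => ∫⁻ θ, ENNReal.ofReal (F n θ) ∂haarAddCircle) atTop :=
        lintegral_liminf_le fun n => (hFcont n).measurable.ennreal_ofReal
    _ ≤ ENNReal.ofReal (C ^ 2) := by
        refine liminf_le_of_frequently_le' (Frequently.of_forall fun n => ?_)
        have hF0 : ∀ t, 0 ≤ F n t := fun t => by positivity
        rw [← ofReal_integral_eq_lintegral_ofReal (integrable_of_continuous (hFcont n))
          (Eventually.of_forall hF0)]
        refine ENNReal.ofReal_le_ofReal ?_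
        have h5 := hC (r n) (hr n).1 (hr n).2
        rw [circleAverage_eq_integral_haarAddCircle, ← Real.sqrt_eq_rpow] at h5
        exact Real.sqrt_le_iff.1 h5 |>.2
    _ < ∞ := ENNReal.ofReal_lt_top

end SzegoFunction

/-! ### Square-summable Maclaurin coefficients and `H₂`. -/

section Parseval

/-- Parseval for `t ↦ F(re^{it})`: the Fourier coefficients are `a_n r^n` for `n ≥ 0` and vanish for
`n < 0`. -/
lemma hasSum_sq_norm_taylor {F : ℂ → ℂ} (hF : DifferentiableOn ℂ F (Metric.ball 0 1)) {r : ℝ}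
    (h0 : 0 ≤ r) (h1 : r < 1) :
    HasSum (fun n : ℕ => ‖iteratedDeriv n F 0 / (n.factorial : ℂ)‖ ^ 2 * (r ^ n) ^ 2)
      (Real.circleAverage (fun z => ‖F z‖ ^ 2) 0 r) := by
  set a : ℕ → ℂ := fun n => iteratedDeriv n F 0 / (n.factorial : ℂ) with ha
  have htaylor : ∀ z ∈ Metric.ball (0 : ℂ) 1, HasSum (fun n => a n * z ^ n) (F z) := by
    intro z hz
    have h2 := Complex.hasSum_taylorSeries_on_ball hF hz
    have h3 : (fun n : ℕ => (n.factorial : ℂ)⁻¹ • (z - 0) ^ n • iteratedDeriv n F 0) =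
        fun n => a n * z ^ n := by
      funext n
      simp only [ha, sub_zero, smul_eq_mul]
      ring
    rwa [h3] at h2
  have hsum : Summable fun n => ‖a n * (r : ℂ) ^ n‖ := by
    refine (htaylor r ?_).summable.norm
    rw [mem_ball_zero_iff, Complex.norm_real, Real.norm_of_nonneg h0]
    exact h1
  set b : ℕ → C(AddCircle (2 * Real.pi), ℂ) := fun n =>
    (a n * (r : ℂ) ^ n) • fourier (n : ℤ) with hb
  have hbsum : Summable b := by
    refine Summable.of_norm ?_
    simpa only [hb, norm_smul, fourier_norm, mul_one] using hsum
  set G : C(AddCircle (2 * Real.pi), ℂ) := ∑' n, b n with hG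
  have hGF : ∀ t, G t = F (r * fourier 1 t) := by
    intro t
    have hz : (r : ℂ) * fourier 1 t ∈ Metric.ball (0 : ℂ) 1 := by
      rw [mem_ball_zero_iff, norm_ofReal_mul_fourier h0]
      exact h1
    have h2 := (ContinuousMap.evalCLM ℂ t).hasSum hbsum.hasSum
    refine h2.unique ?_
    convert htaylor _ hz using 1
    funext n
    simp only [hb, ContinuousMap.evalCLM_apply, ContinuousMap.smul_apply,
      smul_eq_mul, mul_pow]
    rw [fourier_apply, fourier_one, natCast_zsmul, AddCircle.toCircle_nsmul, Circle.coe_pow]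
    ring
  have hcoeff : ∀ m : ℤ, HasSum (fun n : ℕ => a n * (r : ℂ) ^ n * if m = n then 1 else 0)
      (fourierCoeff G m) := by
    intro m
    let L : C(AddCircle (2 * Real.pi), ℂ) →+ ℂ :=
      AddMonoidHom.mk' (fun f => fourierCoeff f m) fun f g => congrFun (fourierCoeff.add
        (integrable_of_continuous f.continuous) (integrable_of_continuous g.continuous)) m
    have hL : Continuous L :=
      (continuous_integral_continuousMap haarAddCircle).comp
        (continuous_const.mul continuous_id : Continuous fun f => fourier (-m) * f)
    have h3 : (fun n : ℕ => a n * (r : ℂ) ^ n * if m = n then 1 else 0) = L ∘ b := by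
      funext n
      have h2 := fourierCoeff.const_smul (fourier (T := 2 * Real.pi) (n : ℤ))
        (a n * (r : ℂ) ^ n) m
      rw [fourierCoeff_fourier, Pi.single_apply, smul_eq_mul] at h2
      exact h2.symm
    rw [h3]
    exact hbsum.hasSum.map L hL
  have hpars := hasSum_sq_fourierCoeff (ContinuousMap.toLp (E := ℂ) 2 haarAddCircle ℂ G)
  simp only [fourierCoeff_toLp] at hpars
  have hint : ∫ t, ‖(ContinuousMap.toLp (E := ℂ) 2 haarAddCircle ℂ G) t‖ ^ 2 ∂haarAddCircle =
      Real.circleAverage (fun z => ‖F z‖ ^ 2) 0 r := by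
    rw [circleAverage_eq_integral_haarAddCircle]
    refine integral_congr_ae ?_
    filter_upwards [ContinuousMap.coeFn_toLp (p := 2) (𝕜 := ℂ) haarAddCircle G] with t ht
    rw [ht, hGF]
  rw [hint] at hpars
  rw [← Function.Injective.hasSum_iff (Nat.cast_injective (R := ℤ))] at hpars
  · convert hpars using 1
    funext n
    have h3 : fourierCoeff G (n : ℤ) = a n * (r : ℂ) ^ n := by
      refine (hcoeff n).unique ?_
      convert hasSum_ite_eq n (a n * (r : ℂ) ^ n) using 1
      funext k
      by_cases hk : k = n
      · simp [hk]
      · have hk' : (n : ℤ) ≠ k := fun h => hk (by exact_mod_cast h.symm)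
        simp [hk, hk']
    rw [Function.comp_apply, h3, norm_mul, mul_pow, norm_pow, Complex.norm_real,
      Real.norm_of_nonneg h0]
  · intro m hm
    have h3 : fourierCoeff G m = 0 := by
      refine (hcoeff m).unique ?_
      convert hasSum_zero using 2 with n
      rw [if_neg, mul_zero]
      rintro rfl
      exact hm ⟨n, rfl⟩
    rw [h3]
    simp

/-- An analytic function on the disc is in `H₂` if and only if its Maclaurin coefficients are square
summable. -/
theorem memHardy_two_iff {F : ℂ → ℂ} (hF : DifferentiableOn ℂ F (Metric.ball 0 1)) :
    MemHardy 2 F ↔ Memℓp (fun n : ℕ => iteratedDeriv n F 0 / (n.factorial : ℂ)) 2 := by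
  rw [memℓp_gen_iff (by norm_num)]
  simp only [ENNReal.toReal_ofNat, Real.rpow_two]
  constructor
  · rintro ⟨-, C, hC⟩
    refine summable_of_sum_range_le (c := C ^ 2) (fun n => by positivity) fun N => ?_
    -- Letting `r → 1` in finite partial sums makes an interchange of limits unnecessary.
    have hlim : Tendsto (fun r : ℝ => ∑ n ∈ Finset.range N,
        ‖iteratedDeriv n F 0 / (n.factorial : ℂ)‖ ^ 2 * (r ^ n) ^ 2) (𝓝[<] 1)
        (𝓝 (∑ n ∈ Finset.range N,
          ‖iteratedDeriv n F 0 / (n.factorial : ℂ)‖ ^ 2 * ((1 : ℝ) ^ n) ^ 2)) := by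
      refine Tendsto.mono_left (Continuous.tendsto ?_ 1) nhdsWithin_le_nhds
      fun_prop
    simp only [one_pow, mul_one] at hlim
    refine le_of_tendsto hlim ?_
    filter_upwards [Ico_mem_nhdsLT (zero_lt_one (α := ℝ))] with r hr
    have hs := hasSum_sq_norm_taylor hF hr.1 hr.2
    refine (sum_le_hasSum _ (fun n _ => by positivity) hs).trans ?_
    have h5 := hC r hr.1 hr.2
    simp only [Real.rpow_two] at h5
    rw [← Real.sqrt_eq_rpow] at h5
    exact Real.sqrt_le_iff.1 h5 |>.2
  · intro hs
    refine ⟨hF, (∑' n : ℕ, ‖iteratedDeriv n F 0 / (n.factorial : ℂ)‖ ^ 2) ^ (1 / (2 : ℝ)),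
      fun r h0 h1 => ?_⟩
    simp only [Real.rpow_two]
    have ht := hasSum_sq_norm_taylor hF h0 h1
    rw [← ht.tsum_eq]
    refine Real.rpow_le_rpow (tsum_nonneg fun n => by positivity) ?_ (by norm_num)
    refine ht.summable.tsum_le_tsum (fun n => ?_) hs
    have : (r ^ n) ^ 2 ≤ 1 := pow_le_one₀ (by positivity) (pow_le_one₀ h0 h1.le)
    exact mul_le_of_le_one_right (by positivity) this

lemma memℓp_arCoeff_iff (μ : Measure (AddCircle (2 * Real.pi))) :
    Memℓp (arCoeff μ) 2 ↔ Memℓp (fun n : ℕ =>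
      iteratedDeriv n (fun z => 1 / szegoFunction μ z) 0 / (n.factorial : ℂ)) 2 := by
  have h : ∀ n, ‖arCoeff μ n‖ =
      ‖iteratedDeriv n (fun z => 1 / szegoFunction μ z) 0 / (n.factorial : ℂ)‖ := by
    intro n
    simp only [arCoeff, neg_div, iteratedDeriv_fun_neg, norm_neg]
  rw [memℓp_gen_iff (by norm_num), memℓp_gen_iff (by norm_num)]
  simp only [h]

end Parseval

/-! ### Comparison of minimality with non-determinism, and the equivalences. -/

section Main

variable {Ω : Type*} [MeasurableSpace Ω] {X : ℤ → Ω → ℂ} {P : Measure Ω}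

lemma isNonDeterministic_iff (hX : IsStationary X P) :
    IsNonDeterministic hX ↔ toL2 hX 0 ∉ cls hX (Set.Iic (-1)) := by
  rw [IsNonDeterministic, sigma, norm_pos_iff, sub_ne_zero, ne_comm, ne_eq,
    Submodule.starProjection_eq_self_iff]

lemma IsMinimal.isNonDeterministic {hX : IsStationary X P} (h : IsMinimal hX) :
    IsNonDeterministic hX := by
  rw [isNonDeterministic_iff]
  intro h0
  refine h 0 (Submodule.topologicalClosure_mono (Submodule.span_mono (Set.image_mono ?_)) h0)
  intro m (hm : m ≤ -1)
  change m ≠ 0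
  omega

end Main

end Prediction

theorem theorem7 {Ω : Type*} [MeasurableSpace Ω] (P : Measure Ω) [IsProbabilityMeasure P]
    (X : ℤ → Ω → ℂ) (hX : Prediction.IsStationary X P) :
    List.TFAE [
      Prediction.IsMinimal hX,
      ∫⁻ θ, (Prediction.density (Prediction.spectralMeasure X P) θ)⁻¹ ∂haarAddCircle < ∞,
      Prediction.IsNonDeterministic hX ∧
        Memℓp (Prediction.arCoeff (Prediction.spectralMeasure X P)) 2,
      Prediction.IsNonDeterministic hX ∧
        Prediction.MemHardy 2
          (fun z => 1 / Prediction.szegoFunction (Prediction.spectralMeasure X P) z)] := by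
  have hμ := Prediction.isSpectralMeasure_spectralMeasure hX
  have := hμ.1
  have hszego := fun h : Prediction.IsNonDeterministic hX =>
    Prediction.integrable_log_density_of_notMem hX hμ ((Prediction.isNonDeterministic_iff hX).1 h)
  -- Minimality at time `0` suffices here; the converse recovers it at every time.
  tfae_have 1 → 2 := fun h => Prediction.lintegral_inv_density_lt_top hX hμ (h 0)
  tfae_have 2 → 1 := Prediction.isMinimal_of_lintegral_inv_density_lt_top hX hμ
  tfae_have 2 → 4 := fun h =>
    ⟨(Prediction.isMinimal_of_lintegral_inv_density_lt_top hX hμ h).isNonDeterministic,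
      Prediction.memHardy_one_div_szegoFunction h⟩
  tfae_have 4 → 2 := fun h => Prediction.lintegral_inv_density_lt_top_of_memHardy
    (hszego h.1).1 (hszego h.1).2 h.2
  tfae_have 3 ↔ 4 := and_congr_right fun h => by
    rw [Prediction.memℓp_arCoeff_iff, Prediction.memHardy_two_iff
      (Prediction.differentiableOn_one_div_szegoFunction (hszego h).2)]
  tfae_finish
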